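/- Let $N\ge 2$ and let $\Omega\subset\mathbb R^N$ be a bounded domain (open and connected) that contains the origin and is symmetric with respect to the hyperplane $T=\{x\in\mathbb R^N: x_1=0\}$. Write $\tilde x=(-x_1,x_2,\dots,x_N)$ for the reflection of $x$ on $T$, and $\Omega_\pm=\{x\in\Omega: \pm x_1>0\}$. Let $f:\Omega\times\mathbb R\to\mathbb R$ be a Carathéodory function (measurable in $x$ for every $t$, continuous in $t$ for a.a. $x$) that is even in $x_1$, i.e. $f(\tilde x,t)=f(x,t)$ for a.a. $x\in\Omega$ and all $t\in\mathbb R$, and let $u_0\in C^2(\Omega)\cap C(\overline\Omega)$ be a classical solution of $$-\Delta u=f(x,u)\ \text{ in }\Omega,\qquad u=0\ \text{ on }\partial\Omega .$$ Assume the following. 1. (Growth) There are $C>0$ and $r>1$, with $r<2N/(N-2)$ if $N\ge 3$, such that $|f(x,t)|\le C(|t|^{r-1}+1)$ for a.a. $x\in\Omega$ and all $t\in\mathbb R$. 2. (Local Lipschitz continuity) For each $M>0$ there is $C_M>0$ such that $|f(x,s)-f(x,t)|\le C_M|s-t|$ for a.a. $x\in\Omega$ and all $s,t\in[-M,M]$.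 Let $F(x,t)=\int_0^t f(x,s)\,ds$, let $$\Phi(u)=\int_\Omega \Big(\tfrac12|\nabla u|^2-F(x,u)\Big)dx,\qquad u\in H^1_0(\Omega),$$ and let $\Psi(u)=\Phi(u+u_0)-\Phi(u_0)$. Set $u_\pm(x)=u_0(\tilde x)-u_0(x)$ for $x\in\Omega_\pm$, and let $u_\pm^-=\max\{-u_\pm,0\}$ be the negative parts, extended by zero to $\Omega$. Assume further: 3. (Convexity) For a.a. $x\in\Omega_+$ such that $u_+^-(x)\ne 0$, and for a.a. $x\in\Omega_-$ such that $u_-^-(x)\neq 0$, the function $f(x,\cdot)$ is convex on $[u_0(\tilde x),\,2u_0(x)-u_0(\tilde x)]$. 4. $u_0$ has a critical point on $T\cap\Omega$. If $u_0$ is not even in $x_1$, then $u_0$ and $u_\pm^-$ belong to $H^1_0(\Omega)$, and for all $(s,t)\in[-1,1]\times[-1,1]$ the function $su_+^-+tu_-^-$ belongs to $H^1_0(\Omega)$, the integral defining $\Phi(su_+^-+tu_-^-+u_0)$ converges absolutely, and $$\Psi(su_+^-+tu_-^-)\le 0 .$$ If, moreover, for a.a. $x\in\Omega_+$ such that $u_+^-(x)\ne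 0$ and for a.a. $x\in\Omega_-$ such that $u_-^-(x)\neq 0$ the function $f(x,\cdot)$ is strictly convex on $[u_0(\tilde x),u_0(x)]$, then $$\Psi(su_+^-+tu_-^-)<0\quad\text{for all }(s,t)\in\big((-1,1)\times(-1,1)\big)\setminus\{(0,0)\}.$$ -/

import Mathlib

open MeasureTheory Set Filter Topology
open scoped ContDiff

noncomputable section

namespace PartialSymmetry

/-- The reflection `x̃ = (-x₁, x₂, …, x_N)` on the hyperplane `T = {x₁ = 0}`. The first coordinate
`x₁` is `x 0`. -/
def reflect {N : ℕ} [NeZero N] (x : EuclideanSpace ℝ (Fin N)) : EuclideanSpace ℝ (Fin N) :=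
  WithLp.toLp 2 (Function.update x.ofLp 0 (-x 0))

/-- The half domain `Ω₊ = {x ∈ Ω : x₁ > 0}`. -/
def halfPos {N : ℕ} [NeZero N] (Ω : Set (EuclideanSpace ℝ (Fin N))) :
    Set (EuclideanSpace ℝ (Fin N)) :=
  {x | x ∈ Ω ∧ 0 < x 0}

/-- The half domain `Ω₋ = {x ∈ Ω : x₁ < 0}`. -/
def halfNeg {N : ℕ} [NeZero N] (Ω : Set (EuclideanSpace ℝ (Fin N))) :
    Set (EuclideanSpace ℝ (Fin N)) :=
  {x | x ∈ Ω ∧ x 0 < 0}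

/-- For `S = Ω₊` or `S = Ω₋`: the negative part `max {-(u₀(x̃) - u₀(x)), 0}` of
`u₀(x̃) - u₀(x)` on `S`, extended by zero outside `S`. -/
def reflNegPart {N : ℕ} [NeZero N] (S : Set (EuclideanSpace ℝ (Fin N)))
    (u₀ : EuclideanSpace ℝ (Fin N) → ℝ) : EuclideanSpace ℝ (Fin N) → ℝ :=
  S.indicator fun x => max (-(u₀ (reflect x) - u₀ x)) 0

/-- Test functions `φ ∈ C_c^∞(Ω)`. -/
def IsTestFunction {N : ℕ} (Ω : Set (EuclideanSpace ℝ (Fin N)))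
    (φ : EuclideanSpace ℝ (Fin N) → ℝ) : Prop :=
  ContDiff ℝ ∞ φ ∧ HasCompactSupport φ ∧ tsupport φ ⊆ Ω

/-- `G` is a weak (distributional) gradient of `u` in `Ω`:
`∫_Ω u ∇φ = - ∫_Ω φ G` for all `φ ∈ C_c^∞(Ω)`. -/
def HasWeakGradient {N : ℕ} (Ω : Set (EuclideanSpace ℝ (Fin N)))
    (u : EuclideanSpace ℝ (Fin N) → ℝ)
    (G : EuclideanSpace ℝ (Fin N) → EuclideanSpace ℝ (Fin N)) : Prop :=
  LocallyIntegrableOn u Ω ∧ LocallyIntegrableOn G Ω ∧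
    ∀ φ, IsTestFunction Ω φ → ∫ x in Ω, u x • gradient φ x = -∫ x in Ω, φ x • G x

open Classical in
/-- The weak gradient of `u` in `Ω` (unique up to null sets of an open `Ω`; zero if there is
none). -/
def weakGradient {N : ℕ} (Ω : Set (EuclideanSpace ℝ (Fin N)))
    (u : EuclideanSpace ℝ (Fin N) → ℝ) : EuclideanSpace ℝ (Fin N) → EuclideanSpace ℝ (Fin N) :=
  if h : ∃ G, HasWeakGradient Ω u G then h.choose else 0

/-- `u ∈ H¹(Ω)`: `u` and its weak gradient exist in `L²(Ω)`. -/
def MemH1 {N : ℕ} (Ω : Set (EuclideanSpace ℝ (Fin N)))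
    (u : EuclideanSpace ℝ (Fin N) → ℝ) : Prop :=
  (∃ G, HasWeakGradient Ω u G) ∧ MemLp u 2 (volume.restrict Ω) ∧
    MemLp (weakGradient Ω u) 2 (volume.restrict Ω)

/-- `u ∈ H¹₀(Ω)`, the closure of `C_c^∞(Ω)` in `H¹(Ω)`. -/
def MemH10 {N : ℕ} (Ω : Set (EuclideanSpace ℝ (Fin N)))
    (u : EuclideanSpace ℝ (Fin N) → ℝ) : Prop :=
  MemH1 Ω u ∧ ∃ φ : ℕ → EuclideanSpace ℝ (Fin N) → ℝ, (∀ n, IsTestFunction Ω (φ n)) ∧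
    Tendsto (fun n => eLpNorm (fun x => u x - φ n x) 2 (volume.restrict Ω)) atTop (𝓝 0) ∧
    Tendsto (fun n => eLpNorm (fun x => weakGradient Ω u x - gradient (φ n) x) 2
      (volume.restrict Ω)) atTop (𝓝 0)

/-- `f` is a Carathéodory function on `Ω × ℝ`: Lebesgue measurable in `x` for every `t`, continuous
in `t` for a.a. `x`. -/
def IsCaratheodory {N : ℕ} (Ω : Set (EuclideanSpace ℝ (Fin N)))
    (f : EuclideanSpace ℝ (Fin N) → ℝ → ℝ) : Prop :=
  (∀ t, AEMeasurable (fun x => f x t) (volume.restrict Ω)) ∧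
    ∀ᵐ x ∂volume.restrict Ω, Continuous (f x)

/-- The integrand `½ |∇u|² - F(x,u)` of `Φ`, where `F(x,t) = ∫₀ᵗ f(x,s) ds`. -/
def energyDensity {N : ℕ} (Ω : Set (EuclideanSpace ℝ (Fin N)))
    (f : EuclideanSpace ℝ (Fin N) → ℝ → ℝ) (u : EuclideanSpace ℝ (Fin N) → ℝ)
    (x : EuclideanSpace ℝ (Fin N)) : ℝ :=
  1 / 2 * ‖weakGradient Ω u x‖ ^ 2 - ∫ s in (0 : ℝ)..(u x), f x s

/-- The functional `Φ(u) = ∫_Ω ½ |∇u|² - F(x,u)`. -/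
def energy {N : ℕ} (Ω : Set (EuclideanSpace ℝ (Fin N)))
    (f : EuclideanSpace ℝ (Fin N) → ℝ → ℝ) (u : EuclideanSpace ℝ (Fin N) → ℝ) : ℝ :=
  ∫ x in Ω, energyDensity Ω f u x

/-- The functional `Ψ(u) = Φ(u + u₀) - Φ(u₀)`. -/
def shiftedEnergy {N : ℕ} (Ω : Set (EuclideanSpace ℝ (Fin N)))
    (f : EuclideanSpace ℝ (Fin N) → ℝ → ℝ) (u₀ u : EuclideanSpace ℝ (Fin N) → ℝ) : ℝ :=
  energy Ω f (fun x => u x + u₀ x) - energy Ω f u₀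

/-- `u₀ ∈ C²(Ω) ∩ C(closure Ω)` is a classical solution of `-Δu = f(x,u)` in `Ω`, `u = 0` on
`∂Ω`. -/
def IsClassicalSolution {N : ℕ} (Ω : Set (EuclideanSpace ℝ (Fin N)))
    (f : EuclideanSpace ℝ (Fin N) → ℝ → ℝ) (u₀ : EuclideanSpace ℝ (Fin N) → ℝ) : Prop :=
  ContDiffOn ℝ 2 u₀ Ω ∧ ContinuousOn u₀ (closure Ω) ∧
    (∀ x ∈ Ω, -((Laplacian.laplacian u₀ : EuclideanSpace ℝ (Fin N) → ℝ) x) = f x (u₀ x)) ∧ ∀ x ∈ frontier Ω, u₀ x = 0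

end PartialSymmetry

end

open PartialSymmetry

open PartialSymmetry
open scoped Laplacian

set_option linter.unusedSectionVars false

/-! ### Green's first identity and mollification. -/

section Calculus

variable {E : Type*} [NormedAddCommGroup E] [InnerProductSpace ℝ E] [FiniteDimensional ℝ E]

/-! Put `w(x) = u₀(x) - u₀(x̃)`, the function `oddDiff u₀`. On a half domain `S` the function `v =
reflNegPart S u₀` is the positive part of `w`, so where `v > 0` one has `u₀ - v = u₀(x̃)` and `u₀ +
v = 2u₀ - u₀(x̃)`. The two functions `v₊`, `v₋` and their gradients have disjoint supports, so `Ψ(s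
v₊ + t v₋)` is a sum of a term in `s` and a term in `t` (`shiftedEnergy_eq`), each of the form `s ∫
∇u₀·∇v + s²/2 ∫ |∇v|² - ∫ ∫_{u₀}^{u₀+sv} f`.

Both gradient integrals turn into integrals of `f`. Testing the equation of `u₀` with `v` gives `∫
∇u₀·∇v = ∫ f(x,u₀) v`. Since `f` is even in `x₁`, `-Δw = f(x,u₀(x)) - f(x,u₀(x̃))`, and testing this
with `v` gives `∫ |∇v|² = ∫ (f(x,u₀) - f(x,u₀-v)) v`. Hence the term equals `∫ ∫_{u₀}^{u₀+sv} (ℓ -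
f)`, where `ℓ` is the line through the graph of `f(x,·)` at `u₀ - v` and `u₀`. By convexity `f ≤ ℓ`
between these two points and `f ≥ ℓ` beyond `u₀`; the orientation of the inner integral makes it
nonpositive for either sign of `s` (`secant_quadratic_le_integral`, `integral_secant_le`).

The strict inequality also needs `v ≠ 0` in both halves (`not_ae_eq_zero_reflNegPart`). Otherwise
`w` has a sign in one half; it is odd, satisfies `|Δw| ≤ L|w|` by the Lipschitz condition, and has
zero gradient at the critical point on `T`. The Hopf lemma and the strong maximum principle then
force `w = 0` near that point, and by connectedness everywhere, so `u₀` would be even.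

The boundary of `Ω` carries no regularity, so membership in `H¹₀` comes from truncation: `C¹`
versions of the positive part that vanish below level `ε` have compact support, and Green's identity
with a bounded Laplacian controls their energies as `ε → 0` (`isH10Pair_indicator_of_pos`). -/

theorem laplacian_eq_sum_fderiv_fderiv {ι : Type*} [Fintype ι] (b : OrthonormalBasis ι ℝ E)
    (W : E → ℝ) (x : E) :
    (Δ W : E → ℝ) x = ∑ i, fderiv ℝ (fderiv ℝ W) x (b i) (b i) := by
  rw [InnerProductSpace.laplacian_eq_iteratedFDeriv_orthonormalBasis W b]
  simp [iteratedFDeriv_two_apply]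

theorem continuousOn_gradient {U : Set E} (hU : IsOpen U) {W : E → ℝ} (hW : ContDiffOn ℝ 1 W U) :
    ContinuousOn (gradient W) U := by
  have h := hW.continuousOn_fderiv_of_isOpen hU le_rfl
  exact (InnerProductSpace.toDual ℝ E).symm.continuous.comp_continuousOn h

theorem contDiffOn_fderiv_one {U : Set E} (hU : IsOpen U) {W : E → ℝ} (hW : ContDiffOn ℝ 2 W U) :
    ContDiffOn ℝ 1 (fderiv ℝ W) U :=
  hW.fderiv_of_isOpen hU (by norm_num)

theorem continuousOn_laplacian {U : Set E} (hU : IsOpen U) {W : E → ℝ} (hW : ContDiffOn ℝ 2 W U) :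
    ContinuousOn (Δ W : E → ℝ) U := by
  have h : ContinuousOn (fderiv ℝ (fderiv ℝ W)) U :=
    (contDiffOn_fderiv_one hU hW).continuousOn_fderiv_of_isOpen hU le_rfl
  have : (Δ W : E → ℝ) = fun x => ∑ i, fderiv ℝ (fderiv ℝ W) x (stdOrthonormalBasis ℝ E i)
      (stdOrthonormalBasis ℝ E i) :=
    funext fun x => laplacian_eq_sum_fderiv_fderiv _ W x
  rw [this]
  refine continuousOn_finsetSum _ fun i _ => ?_
  exact (h.clm_apply continuousOn_const).clm_apply continuousOn_const

theorem continuous_mul_of_tsupport_subset {U : Set E} (hU : IsOpen U) {ψ h : E → ℝ}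
    (hψ : Continuous ψ) (hs : tsupport ψ ⊆ U) (hh : ContinuousOn h U) :
    Continuous fun x => ψ x * h x :=
  (hψ.continuousOn.mul hh).continuous_of_tsupport_subset hU
    ((tsupport_mul_subset_left (f := ψ) (g := h)).trans hs)

variable [MeasurableSpace E] [BorelSpace E]

theorem integrable_mul_of_tsupport_subset {U : Set E} (hU : IsOpen U) {ψ h : E → ℝ}
    (hψ : Continuous ψ) (hc : HasCompactSupport ψ) (hs : tsupport ψ ⊆ U) (hh : ContinuousOn h U) :
    Integrable (fun x => ψ x * h x) :=
  (continuous_mul_of_tsupport_subset hU hψ hs hh).integrable_of_hasCompactSupport hc.mul_right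

/-- Green's first identity against a compactly supported `C¹` function. -/
theorem setIntegral_inner_gradient {U : Set E} (hU : IsOpen U) {W ψ : E → ℝ}
    (hW : ContDiffOn ℝ 2 W U) (hψ : ContDiff ℝ 1 ψ) (hc : HasCompactSupport ψ)
    (hs : tsupport ψ ⊆ U) :
    ∫ x in U, inner ℝ (gradient W x) (gradient ψ x) = ∫ x in U, -(Δ W : E → ℝ) x * ψ x := by
  set b := stdOrthonormalBasis ℝ E
  have hW1 := contDiffOn_fderiv_one hU hW
  have hW2 : ContinuousOn (fderiv ℝ (fderiv ℝ W)) U := hW1.continuousOn_fderiv_of_isOpen hU le_rfl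
  have hψ' : ∀ v, Continuous fun x => fderiv ℝ ψ x v := fun v =>
    (hψ.continuous_fderiv one_ne_zero).clm_apply continuous_const
  have hc' : ∀ v, HasCompactSupport fun x => fderiv ℝ ψ x v := fun v => hc.fderiv_apply ℝ v
  have hD : ∀ v, ContinuousOn (fun x => fderiv ℝ W x v) U := fun v =>
    hW1.continuousOn.clm_apply continuousOn_const
  have hDD : ∀ v, ContinuousOn (fun x => fderiv ℝ (fderiv ℝ W) x v v) U := fun v =>
    (hW2.clm_apply continuousOn_const).clm_apply continuousOn_const
  have hder : ∀ v, ∀ x ∈ U, HasFDerivAt (fun y => fderiv ℝ W y v)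
      ((ContinuousLinearMap.apply ℝ ℝ v).comp (fderiv ℝ (fderiv ℝ W) x)) x := fun v x hx =>
    (ContinuousLinearMap.apply ℝ ℝ v).hasFDerivAt.comp x
      ((hW1.differentiableOn one_ne_zero x hx).differentiableAt (hU.mem_nhds hx)).hasFDerivAt
  have I1 : ∀ v, Integrable fun x => fderiv ℝ ψ x v * fderiv ℝ W x v := fun v =>
    integrable_mul_of_tsupport_subset hU (hψ' v) (hc' v)
      ((tsupport_fderiv_apply_subset ℝ v).trans hs) (hD v)
  have I2 : ∀ v, Integrable fun x => ψ x * fderiv ℝ (fderiv ℝ W) x v v := fun v =>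
    integrable_mul_of_tsupport_subset hU hψ.continuous hc hs (hDD v)
  have key : ∀ v, ∫ x, ψ x * fderiv ℝ (fderiv ℝ W) x v v
      = -∫ x, fderiv ℝ ψ x v * fderiv ℝ W x v := by
    intro v
    -- Differentiability of `∇W` is needed only on the support of `ψ`, which lies in `U`; the
    -- integrals run over the whole space, so no boundary term appears.
    have := integral_bilinear_hasFDerivAt_right_eq_neg_left_of_integrable (μ := volume)
      (B := ContinuousLinearMap.mul ℝ ℝ) (f := ψ) (f' := fderiv ℝ ψ) (v := v)
      (g := fun y => fderiv ℝ W y v)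
      (g' := fun x => (ContinuousLinearMap.apply ℝ ℝ v).comp (fderiv ℝ (fderiv ℝ W) x))
      (I1 v) (I2 v)
      (integrable_mul_of_tsupport_subset hU hψ.continuous hc hs (hD v))
      (fun x _ => (hψ.differentiable one_ne_zero x).hasFDerivAt)
      (fun x hx => hder v x (hs hx))
    simpa using this
  have hsub : ∀ v, tsupport (fun x => fderiv ℝ ψ x v) ⊆ U := fun v =>
    (tsupport_fderiv_apply_subset ℝ v).trans hs
  have e1 : ∫ x in U, inner ℝ (gradient W x) (gradient ψ x)
      = ∫ x, ∑ i, fderiv ℝ ψ x (b i) * fderiv ℝ W x (b i) := by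
    rw [setIntegral_eq_integral_of_forall_compl_eq_zero]
    · refine integral_congr_ae (.of_forall fun x => ?_)
      simp only
      rw [← b.sum_inner_mul_inner]
      refine Finset.sum_congr rfl fun i _ => ?_
      rw [inner_gradient_left, real_inner_comm, inner_gradient_left, mul_comm]
    · intro x hx
      have : gradient ψ x = 0 := by
        have h0 : fderiv ℝ ψ x = 0 := by
          by_contra h
          exact hx (hs (support_fderiv_subset ℝ h))
        simp [gradient, h0]
      rw [this, inner_zero_right]
  have e2 : ∫ x in U, -(Δ W : E → ℝ) x * ψ x
      = ∫ x, -∑ i, ψ x * fderiv ℝ (fderiv ℝ W) x (b i) (b i) := by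
    rw [setIntegral_eq_integral_of_forall_compl_eq_zero]
    · refine integral_congr_ae (.of_forall fun x => ?_)
      simp only
      rw [laplacian_eq_sum_fderiv_fderiv b, ← Finset.mul_sum]
      ring
    · intro x hx
      rw [image_eq_zero_of_notMem_tsupport fun h => hx (hs h), mul_zero]
  rw [e1, e2, integral_neg, integral_finsetSum _ fun i _ => I1 (b i),
    integral_finsetSum _ fun i _ => I2 (b i), ← Finset.sum_neg_distrib]
  exact Finset.sum_congr rfl fun i _ => by rw [key, neg_neg]

/-- Mollification: a compactly supported `C¹` function is `C¹`-close to a smooth function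
supported near its support. -/
theorem exists_contDiff_approx {ψ : E → ℝ} (hψ : ContDiff ℝ 1 ψ) (hc : HasCompactSupport ψ)
    {δ : ℝ} (hδ : 0 < δ) :
    ∃ φ : E → ℝ, ContDiff ℝ ∞ φ ∧ tsupport φ ⊆ Metric.cthickening δ (tsupport ψ) ∧
      (∀ x, dist (φ x) (ψ x) ≤ δ) ∧ ∀ x, dist (fderiv ℝ φ x) (fderiv ℝ ψ x) ≤ δ := by
  have hd := hψ.continuous_fderiv one_ne_zero
  obtain ⟨ρ₁, hρ₁, h₁⟩ := Metric.uniformContinuous_iff.1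
    (hc.uniformContinuous_of_continuous hψ.continuous) δ hδ
  obtain ⟨ρ₂, hρ₂, h₂⟩ := Metric.uniformContinuous_iff.1
    ((hc.fderiv ℝ).uniformContinuous_of_continuous hd) δ hδ
  -- The bound `δ` keeps the support in the thickening; `ρ₁` and `ρ₂` come from the uniform
  -- continuity of `ψ` and of its derivative.
  set ρ := min δ (min ρ₁ ρ₂)
  have hρ : 0 < ρ := lt_min hδ (lt_min hρ₁ hρ₂)
  let b : ContDiffBump (0 : E) := ⟨ρ / 2, ρ, half_pos hρ, half_lt_self hρ⟩
  have hψl : LocallyIntegrable ψ := hψ.continuous.locallyIntegrable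
  set φ : E → ℝ := MeasureTheory.convolution (b.normed volume) ψ (ContinuousLinearMap.lsmul ℝ ℝ)
    volume with hφ
  have hbl : LocallyIntegrable (b.normed (volume : Measure E)) :=
    (b.continuous_normed (μ := volume)).locallyIntegrable
  have hφd : ∀ x, HasFDerivAt φ ((MeasureTheory.convolution (b.normed volume) (fderiv ℝ ψ)
      (ContinuousLinearMap.lsmul ℝ ℝ) volume : E → (E →L[ℝ] ℝ)) x) x := by
    intro x
    have h := hc.hasFDerivAt_convolution_right (ContinuousLinearMap.lsmul ℝ ℝ) hbl hψ x
    -- The derivative of the convolution is the average of `fderiv ℝ ψ` itself, so the estimate for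
    -- averages applies to it as it does to `φ`.
    have e : (MeasureTheory.convolution (b.normed volume) (fderiv ℝ ψ)
        (ContinuousLinearMap.lsmul ℝ ℝ) volume : E → (E →L[ℝ] ℝ)) x
        = MeasureTheory.convolution (b.normed volume) (fderiv ℝ ψ)
          (ContinuousLinearMap.precompR E (ContinuousLinearMap.lsmul ℝ ℝ)) volume x := by
      simp only [MeasureTheory.convolution]
      rfl
    rw [e]
    exact h
  refine ⟨φ, ?_, ?_, ?_, ?_⟩
  · exact (b.hasCompactSupport_normed (μ := volume)).contDiff_convolution_left _
      (b.contDiff_normed (μ := volume)) hψl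
  · refine closure_minimal ?_ Metric.isClosed_cthickening
    refine (MeasureTheory.support_convolution_subset _).trans ?_
    rintro _ ⟨x, hx, y, hy, rfl⟩
    rw [b.support_normed_eq] at hx
    refine Metric.mem_cthickening_of_dist_le _ y _ _ (subset_tsupport _ hy) ?_
    have : ‖x‖ < ρ := by simpa [b] using hx
    rw [dist_eq_norm, add_sub_cancel_right]
    exact this.le.trans (min_le_left _ _)
  · intro x
    refine b.dist_normed_convolution_le hψ.continuous.aestronglyMeasurable fun y hy => ?_
    exact (h₁ (lt_of_lt_of_le hy ((min_le_right _ _).trans (min_le_left _ _)))).le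
  · intro x
    rw [(hφd x).fderiv]
    refine b.dist_normed_convolution_le hd.aestronglyMeasurable fun y hy => ?_
    exact (h₂ (lt_of_lt_of_le hy ((min_le_right _ _).trans (min_le_right _ _)))).le

end Calculus

/-! ### Continuity of the `L²` pairing. -/

section L2

variable {α F : Type*} [MeasurableSpace α] {μ : Measure α} [NormedAddCommGroup F]
  [InnerProductSpace ℝ F]

theorem tendsto_integral_inner_of_tendsto_eLpNorm {f : ℕ → α → F} {f₀ g : α → F}
    (hf : ∀ n, MemLp (f n) 2 μ) (hf₀ : MemLp f₀ 2 μ) (hg : MemLp g 2 μ)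
    (h : Tendsto (fun n => eLpNorm (f n - f₀) 2 μ) atTop (𝓝 0)) :
    Tendsto (fun n => ∫ x, inner ℝ (f n x) (g x) ∂μ) atTop (𝓝 (∫ x, inner ℝ (f₀ x) (g x) ∂μ)) := by
  have h1 := (Lp.tendsto_Lp_iff_tendsto_eLpNorm'' f hf f₀ hf₀).2 h
  have h2 : Tendsto (fun n => (inner ℝ ((hf n).toLp (f n)) (hg.toLp g) : ℝ)) atTop
      (𝓝 (inner ℝ (hf₀.toLp f₀) (hg.toLp g))) := h1.inner tendsto_const_nhds
  have e : ∀ (k : α → F) (hk : MemLp k 2 μ),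
      (inner ℝ (hk.toLp k) (hg.toLp g) : ℝ) = ∫ x, inner ℝ (k x) (g x) ∂μ := by
    intro k hk
    rw [L2.inner_def]
    refine integral_congr_ae ?_
    filter_upwards [hk.coeFn_toLp, hg.coeFn_toLp] with x hx hx'
    rw [hx, hx']
  simpa only [e] using h2

end L2

section Gradient

variable {E : Type*} [NormedAddCommGroup E] [InnerProductSpace ℝ E] [FiniteDimensional ℝ E]

theorem norm_gradient_sub_gradient (φ ψ : E → ℝ) (x : E) :
    ‖gradient φ x - gradient ψ x‖ = ‖fderiv ℝ φ x - fderiv ℝ ψ x‖ := by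
  rw [gradient, gradient, ← map_sub, LinearIsometryEquiv.norm_map]

theorem gradient_eq_zero_of_notMem_tsupport {φ : E → ℝ} {x : E} (hx : x ∉ tsupport φ) :
    gradient φ x = 0 := by
  have h0 : fderiv ℝ φ x = 0 := by
    by_contra h
    exact hx (support_fderiv_subset ℝ h)
  simp [gradient, h0]

theorem ContDiff.continuous_gradient {φ : E → ℝ} (hφ : ContDiff ℝ 1 φ) :
    Continuous (gradient φ) :=
  (InnerProductSpace.toDual ℝ E).symm.continuous.comp (hφ.continuous_fderiv one_ne_zero)

theorem HasCompactSupport.gradient {φ : E → ℝ} (hφ : HasCompactSupport φ) :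
    HasCompactSupport (gradient φ) :=
  hφ.mono' fun x hx => by
    by_contra h
    exact hx (gradient_eq_zero_of_notMem_tsupport h)

end Gradient

/-! ### The space `H¹₀` as pairs of a function and its gradient. -/

namespace PartialSymmetry

variable {N : ℕ}

local notation "E" => EuclideanSpace ℝ (Fin N)

variable {Ω : Set (EuclideanSpace ℝ (Fin N))}

theorem IsTestFunction.memLp {φ : E → ℝ} (h : IsTestFunction Ω φ) :
    MemLp φ 2 (volume.restrict Ω) :=
  (h.1.continuous.memLp_of_hasCompactSupport h.2.1).restrict Ω

theorem IsTestFunction.memLp_gradient {φ : E → ℝ} (h : IsTestFunction Ω φ) :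
    MemLp (gradient φ) 2 (volume.restrict Ω) :=
  ((h.1.of_le (by simp)).continuous_gradient.memLp_of_hasCompactSupport h.2.1.gradient).restrict Ω

theorem IsTestFunction.add {φ ψ : E → ℝ} (h : IsTestFunction Ω φ) (h' : IsTestFunction Ω ψ) :
    IsTestFunction Ω (φ + ψ) :=
  ⟨h.1.add h'.1, h.2.1.add h'.2.1,
    (tsupport_add φ ψ).trans (union_subset h.2.2 h'.2.2)⟩

theorem IsTestFunction.const_smul {φ : E → ℝ} (h : IsTestFunction Ω φ) (c : ℝ) :
    IsTestFunction Ω (c • φ) :=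
  ⟨h.1.const_smul c, h.2.1.smul_left (f := fun _ => c),
    (tsupport_smul_subset_right (fun _ => c) φ).trans h.2.2⟩

theorem IsTestFunction.differentiable {φ : E → ℝ} (h : IsTestFunction Ω φ) :
    Differentiable ℝ φ :=
  h.1.differentiable (by simp)

/-- `u` and `G` are square integrable, and `(u, G)` is an `L²(Ω)`-limit of pairs `(φ, ∇φ)` with
test functions `φ`; that is, `u ∈ H¹₀(Ω)` and `G` is its weak gradient. -/
def IsH10Pair (Ω : Set (EuclideanSpace ℝ (Fin N))) (u : EuclideanSpace ℝ (Fin N) → ℝ)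
    (G : EuclideanSpace ℝ (Fin N) → EuclideanSpace ℝ (Fin N)) : Prop :=
  MemLp u 2 (volume.restrict Ω) ∧ MemLp G 2 (volume.restrict Ω) ∧
    ∀ ε : ENNReal, ε ≠ 0 → ∃ φ, IsTestFunction Ω φ ∧
      eLpNorm (u - φ) 2 (volume.restrict Ω) ≤ ε ∧
      eLpNorm (G - gradient φ) 2 (volume.restrict Ω) ≤ ε

variable {u v : EuclideanSpace ℝ (Fin N) → ℝ}
  {G H : EuclideanSpace ℝ (Fin N) → EuclideanSpace ℝ (Fin N)}

theorem IsH10Pair.congr (h : IsH10Pair Ω u G) (hu : u =ᵐ[volume.restrict Ω] v)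
    (hG : G =ᵐ[volume.restrict Ω] H) : IsH10Pair Ω v H := by
  refine ⟨(memLp_congr_ae hu).1 h.1, (memLp_congr_ae hG).1 h.2.1, fun ε hε => ?_⟩
  obtain ⟨φ, hφ, h1, h2⟩ := h.2.2 ε hε
  refine ⟨φ, hφ, ?_, ?_⟩
  · rwa [← eLpNorm_congr_ae (hu.sub .rfl)]
  · rwa [← eLpNorm_congr_ae (hG.sub .rfl)]

theorem IsH10Pair.add (h : IsH10Pair Ω u G) (h' : IsH10Pair Ω v H) :
    IsH10Pair Ω (u + v) (G + H) := by
  refine ⟨h.1.add h'.1, h.2.1.add h'.2.1, fun ε hε => ?_⟩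
  obtain ⟨φ, hφ, h1, h2⟩ := h.2.2 (ε / 2) (by simpa using hε)
  obtain ⟨ψ, hψ, h3, h4⟩ := h'.2.2 (ε / 2) (by simpa using hε)
  refine ⟨φ + ψ, hφ.add hψ, ?_, ?_⟩
  · rw [add_sub_add_comm, ← ENNReal.add_halves ε]
    exact (eLpNorm_add_le (h.1.sub hφ.memLp).1 (h'.1.sub hψ.memLp).1 one_le_two).trans
      (add_le_add h1 h3)
  · have e : gradient (φ + ψ) = gradient φ + gradient ψ := by
      funext x
      simp only [gradient, Pi.add_apply]
      rw [fderiv_add (hφ.differentiable x) (hψ.differentiable x), map_add]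
    rw [e, add_sub_add_comm, ← ENNReal.add_halves ε]
    exact (eLpNorm_add_le (h.2.1.sub hφ.memLp_gradient).1 (h'.2.1.sub hψ.memLp_gradient).1
      one_le_two).trans (add_le_add h2 h4)

theorem IsH10Pair.const_smul (h : IsH10Pair Ω u G) (c : ℝ) : IsH10Pair Ω (c • u) (c • G) := by
  refine ⟨h.1.const_smul c, h.2.1.const_smul c, fun ε hε => ?_⟩
  -- For `c = 0` the quotient is `⊤`, and the bound it gives is still usable because `0 * ⊤ = 0`.
  obtain ⟨φ, hφ, h1, h2⟩ := h.2.2 (ε / ‖c‖ₑ) (by simp [ENNReal.div_eq_zero_iff, hε])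
  refine ⟨c • φ, hφ.const_smul c, ?_, ?_⟩
  · rw [← smul_sub, eLpNorm_const_smul]
    exact (mul_le_mul_right h1 _).trans ENNReal.mul_div_le
  · have e : gradient (c • φ) = c • gradient φ := by
      funext x
      simp only [gradient, Pi.smul_apply]
      rw [fderiv_const_smul (hφ.differentiable x)]
      simp
    rw [e, ← smul_sub, eLpNorm_const_smul]
    exact (mul_le_mul_right h2 _).trans ENNReal.mul_div_le

theorem IsH10Pair.of_tendsto {un : ℕ → E → ℝ} {Gn : ℕ → E → E} (h : ∀ n, IsH10Pair Ω (un n) (Gn n))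
    (hu : MemLp u 2 (volume.restrict Ω)) (hG : MemLp G 2 (volume.restrict Ω))
    (hun : Tendsto (fun n => eLpNorm (un n - u) 2 (volume.restrict Ω)) atTop (𝓝 0))
    (hGn : Tendsto (fun n => eLpNorm (Gn n - G) 2 (volume.restrict Ω)) atTop (𝓝 0)) :
    IsH10Pair Ω u G := by
  refine ⟨hu, hG, fun ε hε => ?_⟩
  have hε2 : 0 < ε / 2 := by simpa [pos_iff_ne_zero] using hε
  obtain ⟨n, h1, h2⟩ :=
    ((hun.eventually (ge_mem_nhds hε2)).and (hGn.eventually (ge_mem_nhds hε2))).exists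
  obtain ⟨φ, hφ, h3, h4⟩ := (h n).2.2 (ε / 2) hε2.ne'
  refine ⟨φ, hφ, ?_, ?_⟩
  · rw [← sub_add_sub_cancel u (un n) φ, ← ENNReal.add_halves ε]
    refine (eLpNorm_add_le (hu.sub (h n).1).1 ((h n).1.sub hφ.memLp).1 one_le_two).trans
      (add_le_add ?_ h3)
    rwa [eLpNorm_sub_comm]
  · rw [← sub_add_sub_cancel G (Gn n) (gradient φ), ← ENNReal.add_halves ε]
    refine (eLpNorm_add_le (hG.sub (h n).2.1).1 ((h n).2.1.sub hφ.memLp_gradient).1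
      one_le_two).trans (add_le_add ?_ h4)
    rwa [eLpNorm_sub_comm]

theorem IsH10Pair.exists_seq (h : IsH10Pair Ω u G) :
    ∃ φ : ℕ → E → ℝ, (∀ n, IsTestFunction Ω (φ n)) ∧
      Tendsto (fun n => eLpNorm (u - φ n) 2 (volume.restrict Ω)) atTop (𝓝 0) ∧
      Tendsto (fun n => eLpNorm (G - gradient (φ n)) 2 (volume.restrict Ω)) atTop (𝓝 0) := by
  have h' : ∀ n : ℕ, ((n : ENNReal) + 1)⁻¹ ≠ 0 := fun n => by simp
  choose φ hφ h1 h2 using fun n : ℕ => h.2.2 _ (h' n)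
  have hlim : Tendsto (fun n : ℕ => ((n : ENNReal) + 1)⁻¹) atTop (𝓝 0) := by
    have := (tendsto_add_atTop_iff_nat 1).2 ENNReal.tendsto_inv_nat_nhds_zero
    simpa using this
  exact ⟨φ, hφ, tendsto_of_tendsto_of_tendsto_of_le_of_le tendsto_const_nhds hlim
    (fun _ => zero_le) h1, tendsto_of_tendsto_of_tendsto_of_le_of_le tendsto_const_nhds hlim
    (fun _ => zero_le) h2⟩

/-- Mollifying at scale `δ` keeps the support inside `Ω` and moves `ψ` and `∇ψ` by at most `δ`
uniformly; on a set of finite measure this is an `L²` error of at most `A δ` with `A = |Ω|^(1/2)`.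
-/
theorem IsH10Pair.of_contDiff_one (hΩ : IsOpen Ω) (hfin : volume Ω ≠ ⊤) {ψ : E → ℝ}
    (hψ : ContDiff ℝ 1 ψ) (hc : HasCompactSupport ψ) (hs : tsupport ψ ⊆ Ω) :
    IsH10Pair Ω ψ (gradient ψ) := by
  refine ⟨(hψ.continuous.memLp_of_hasCompactSupport hc).restrict Ω,
    (hψ.continuous_gradient.memLp_of_hasCompactSupport hc.gradient).restrict Ω, fun ε hε => ?_⟩
  obtain ⟨δ₀, hδ₀, hsub⟩ := hc.isCompact.exists_cthickening_subset_open hΩ hs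
  set A := (volume.restrict Ω) univ ^ (2 : ENNReal).toReal⁻¹
  have hA : A ≠ ⊤ := by
    refine ENNReal.rpow_ne_top_of_nonneg (by simp) ?_
    simpa using hfin
  have hlim : Tendsto (fun δ : ℝ => A * ENNReal.ofReal δ) (𝓝[>] 0) (𝓝 0) := by
    have h1 : Tendsto (fun δ : ℝ => A * ENNReal.ofReal δ) (𝓝 0) (𝓝 (A * ENNReal.ofReal 0)) :=
      ENNReal.Tendsto.const_mul (ENNReal.tendsto_ofReal tendsto_id) (.inr hA)
    simp only [ENNReal.ofReal_zero, mul_zero] at h1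
    exact h1.mono_left nhdsWithin_le_nhds
  obtain ⟨δ, hδε, hδ, hδδ⟩ := ((hlim.eventually (ge_mem_nhds (pos_iff_ne_zero.2 hε))).and
    (Ioo_mem_nhdsGT hδ₀)).exists
  obtain ⟨φ, hφ, hφs, h1, h2⟩ := exists_contDiff_approx hψ hc hδ
  have hsub' : tsupport φ ⊆ Metric.cthickening δ₀ (tsupport ψ) :=
    hφs.trans (Metric.cthickening_mono hδδ.le _)
  refine ⟨φ, ⟨hφ, ?_, hsub'.trans hsub⟩, ?_, ?_⟩
  · exact hc.isCompact.cthickening.of_isClosed_subset (isClosed_tsupport φ) hsub'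
  · refine (eLpNorm_le_of_ae_bound (C := δ) (.of_forall fun x => ?_)).trans hδε
    have := h1 x
    rwa [dist_comm, dist_eq_norm] at this
  · refine (eLpNorm_le_of_ae_bound (C := δ) (.of_forall fun x => ?_)).trans hδε
    have := h2 x
    rwa [dist_comm, dist_eq_norm, ← norm_gradient_sub_gradient] at this

theorem IsTestFunction.setIntegral_mul_fderiv {φ ψ : E → ℝ} (hφ : IsTestFunction Ω φ)
    (hψ : IsTestFunction Ω ψ) (c : E) :
    ∫ x in Ω, ψ x * fderiv ℝ φ x c = -∫ x in Ω, fderiv ℝ ψ x c * φ x := by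
  have hd : ∀ {χ : E → ℝ}, IsTestFunction Ω χ → Continuous fun x => fderiv ℝ χ x c := fun hχ =>
    (hχ.1.continuous_fderiv (by simp)).clm_apply continuous_const
  rw [setIntegral_eq_integral_of_forall_compl_eq_zero,
    setIntegral_eq_integral_of_forall_compl_eq_zero]
  · refine integral_mul_fderiv_eq_neg_fderiv_mul_of_integrable ?_ ?_ ?_
      (fun x _ => hψ.differentiable x) (fun x _ => hφ.differentiable x)
    · exact ((hd hψ).mul hφ.1.continuous).integrable_of_hasCompactSupport hφ.2.1.mul_left
    · exact (hψ.1.continuous.mul (hd hφ)).integrable_of_hasCompactSupport hψ.2.1.mul_right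
    · exact (hψ.1.continuous.mul hφ.1.continuous).integrable_of_hasCompactSupport hψ.2.1.mul_right
  · intro x hx
    rw [image_eq_zero_of_notMem_tsupport fun h => hx (hφ.2.2 h), mul_zero]
  · intro x hx
    rw [image_eq_zero_of_notMem_tsupport fun h => hx (hψ.2.2 h), zero_mul]

/-- Integration by parts between two test functions passes to the `L²` limit. The vector identity is
checked after pairing with a constant vector `c`, which reduces it to scalar integrals. -/
theorem IsH10Pair.hasWeakGradient (hfin : volume Ω ≠ ⊤) (h : IsH10Pair Ω u G) :
    HasWeakGradient Ω u G := by
  have : IsFiniteMeasure (volume.restrict Ω) := ⟨by simpa [lt_top_iff_ne_top] using hfin⟩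
  have hui : Integrable u (volume.restrict Ω) := h.1.integrable one_le_two
  have hGi : Integrable G (volume.restrict Ω) := h.2.1.integrable one_le_two
  refine ⟨IntegrableOn.locallyIntegrableOn hui, IntegrableOn.locallyIntegrableOn hGi,
    fun φ hφ => ?_⟩
  have hgc : Continuous (gradient φ) := (hφ.1.of_le (by simp)).continuous_gradient
  obtain ⟨C₁, hC₁⟩ := hgc.bounded_above_of_compact_support hφ.2.1.gradient
  obtain ⟨C₂, hC₂⟩ := hφ.1.continuous.bounded_above_of_compact_support hφ.2.1
  have I1 : Integrable (fun x => u x • gradient φ x) (volume.restrict Ω) :=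
    hui.smul_bdd C₁ hgc.aestronglyMeasurable (.of_forall hC₁)
  have I2 : Integrable (fun x => φ x • G x) (volume.restrict Ω) :=
    hGi.bdd_smul C₂ hφ.1.continuous.aestronglyMeasurable (.of_forall hC₂)
  refine ext_inner_left ℝ fun c => ?_
  rw [inner_neg_right, ← integral_inner I1, ← integral_inner I2]
  simp only [inner_smul_right]
  obtain ⟨ψ, hψ, hψu, hψG⟩ := h.exists_seq
  have hc : ∀ (χ : E → ℝ) x, inner ℝ c (gradient χ x) = fderiv ℝ χ x c := fun χ x => by
    rw [real_inner_comm, inner_gradient_left]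
  have m1 : MemLp (fun x => fderiv ℝ φ x c) 2 (volume.restrict Ω) := by
    have hd : Continuous fun x => fderiv ℝ φ x c :=
      (hφ.1.continuous_fderiv (by simp)).clm_apply continuous_const
    exact (hd.memLp_of_hasCompactSupport (hφ.2.1.fderiv_apply ℝ c)).restrict Ω
  have m2 : MemLp (fun x => φ x • c) 2 (volume.restrict Ω) :=
    ((hφ.1.continuous.smul continuous_const).memLp_of_hasCompactSupport
      (hφ.2.1.smul_right)).restrict Ω
  have t1 := tendsto_integral_inner_of_tendsto_eLpNorm (fun n => (hψ n).memLp) h.1 m1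
    (by simpa only [eLpNorm_sub_comm] using hψu)
  have t2 := tendsto_integral_inner_of_tendsto_eLpNorm (fun n => (hψ n).memLp_gradient) h.2.1 m2
    (by simpa only [eLpNorm_sub_comm] using hψG)
  have e : ∀ n, ∫ x in Ω, inner ℝ (ψ n x) (fderiv ℝ φ x c)
      = -∫ x in Ω, inner ℝ (gradient (ψ n) x) (φ x • c) := by
    intro n
    have := hφ.setIntegral_mul_fderiv (hψ n) c
    simp only [inner_smul_right, inner_gradient_left]
    simpa [mul_comm] using this
  have := tendsto_nhds_unique t1 (t2.neg.congr fun n => (e n).symm)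
  simp only [inner_smul_right] at this
  simp only [hc]
  simpa [mul_comm, real_inner_comm] using this

/-- The difference of two weak gradients integrates to zero against every test function, so the
fundamental lemma of the calculus of variations applies. -/
theorem HasWeakGradient.ae_eq (hΩ : IsOpen Ω) (h : HasWeakGradient Ω u G)
    (h' : HasWeakGradient Ω u H) : G =ᵐ[volume.restrict Ω] H := by
  have I : ∀ {K : E → E}, LocallyIntegrableOn K Ω → ∀ φ, IsTestFunction Ω φ →
      Integrable (fun x => φ x • K x) := by
    intro K hK φ hφ
    have h1 : IntegrableOn K (tsupport φ) :=
      hK.integrableOn_compact_subset hφ.2.2 hφ.2.1.isCompact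
    obtain ⟨C, hC⟩ := hφ.1.continuous.bounded_above_of_compact_support hφ.2.1
    have h2 : IntegrableOn (fun x => φ x • K x) (tsupport φ) :=
      Integrable.bdd_smul h1 C hφ.1.continuous.aestronglyMeasurable (.of_forall hC)
    refine (integrableOn_iff_integrable_of_support_subset fun x hx => ?_).1 h2
    by_contra hx'
    exact hx (by simp [image_eq_zero_of_notMem_tsupport hx'])
  have key := hΩ.ae_eq_zero_of_integral_contDiff_smul_eq_zero (μ := volume)
    (f := fun x => G x - H x) (h.2.1.sub h'.2.1) (fun φ h1 h2 h3 => by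
      have hφ : IsTestFunction Ω φ := ⟨h1, h2, h3⟩
      simp only [smul_sub]
      rw [integral_sub (I h.2.1 φ hφ) (I h'.2.1 φ hφ), sub_eq_zero]
      have e : ∀ K : E → E, ∫ x in Ω, φ x • K x = ∫ x, φ x • K x := fun K =>
        setIntegral_eq_integral_of_forall_compl_eq_zero fun x hx => by
          rw [image_eq_zero_of_notMem_tsupport fun h => hx (h3 h), zero_smul]
      rw [← e, ← e, ← neg_inj, ← h.2.2 φ hφ, ← h'.2.2 φ hφ])
  refine (ae_restrict_iff' hΩ.measurableSet).2 (key.mono fun x hx hxΩ => sub_eq_zero.1 (hx hxΩ))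

/-- `weakGradient` is an arbitrary choice; uniqueness allows the energy to be computed with an
explicit gradient instead. -/
theorem IsH10Pair.weakGradient_ae_eq (hΩ : IsOpen Ω) (hfin : volume Ω ≠ ⊤)
    (h : IsH10Pair Ω u G) : weakGradient Ω u =ᵐ[volume.restrict Ω] G := by
  have hex : ∃ G, HasWeakGradient Ω u G := ⟨G, h.hasWeakGradient hfin⟩
  rw [weakGradient, dif_pos hex]
  exact hex.choose_spec.ae_eq hΩ (h.hasWeakGradient hfin)

theorem IsH10Pair.memH10 (hΩ : IsOpen Ω) (hfin : volume Ω ≠ ⊤) (h : IsH10Pair Ω u G) :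
    MemH10 Ω u := by
  have hw := h.weakGradient_ae_eq hΩ hfin
  refine ⟨⟨⟨G, h.hasWeakGradient hfin⟩, h.1, (memLp_congr_ae hw).2 h.2.1⟩, ?_⟩
  obtain ⟨φ, hφ, h1, h2⟩ := h.exists_seq
  refine ⟨φ, hφ, h1, h2.congr fun n => ?_⟩
  exact eLpNorm_congr_ae (hw.symm.sub .rfl)

/-- A classical solution of `-ΔW = g` with `∇W, ΔW ∈ L²(Ω)` is a weak solution, tested with
`H¹₀(Ω)`. -/
theorem IsH10Pair.setIntegral_inner_gradient (hΩ : IsOpen Ω) (h : IsH10Pair Ω u G) {W : E → ℝ}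
    (hW : ContDiffOn ℝ 2 W Ω) (hW1 : MemLp (gradient W) 2 (volume.restrict Ω))
    (hW2 : MemLp (Δ W : E → ℝ) 2 (volume.restrict Ω)) :
    ∫ x in Ω, inner ℝ (gradient W x) (G x) = ∫ x in Ω, -(Δ W : E → ℝ) x * u x := by
  obtain ⟨ψ, hψ, hψu, hψG⟩ := h.exists_seq
  have t1 := tendsto_integral_inner_of_tendsto_eLpNorm (fun n => (hψ n).memLp) h.1 hW2.neg
    (by simpa only [eLpNorm_sub_comm] using hψu)
  have t2 := tendsto_integral_inner_of_tendsto_eLpNorm (fun n => (hψ n).memLp_gradient) h.2.1 hW1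
    (by simpa only [eLpNorm_sub_comm] using hψG)
  have e : ∀ n, ∫ x in Ω, inner ℝ (gradient (ψ n) x) (gradient W x)
      = ∫ x in Ω, inner ℝ (ψ n x) ((-(Δ W : E → ℝ)) x) := by
    intro n
    have := _root_.setIntegral_inner_gradient hΩ hW ((hψ n).1.of_le (by simp)) (hψ n).2.1
      (hψ n).2.2
    have e' : ∀ x, (inner ℝ (gradient (ψ n) x) (gradient W x) : ℝ)
        = inner ℝ (gradient W x) (gradient (ψ n) x) := fun x => real_inner_comm _ _
    simp only [e', this]
    simp [mul_comm]
  have := tendsto_nhds_unique t2 (t1.congr fun n => (e n).symm)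
  simpa [real_inner_comm] using this

end PartialSymmetry

/-! ### Dominated convergence in `L²` and a `C¹` approximation of the positive part. -/

theorem tendsto_eLpNorm_two_of_dominated {α F : Type*} [MeasurableSpace α] {μ : Measure α}
    [NormedAddCommGroup F] {f : ℕ → α → F} {f₀ : α → F} {g : α → ℝ}
    (hf : ∀ n, AEStronglyMeasurable (f n) μ) (hf₀ : AEStronglyMeasurable f₀ μ) (hg : MemLp g 2 μ)
    (hle : ∀ n, ∀ᵐ x ∂μ, ‖f n x - f₀ x‖ ≤ g x)
    (hlim : ∀ᵐ x ∂μ, Tendsto (fun n => f n x) atTop (𝓝 (f₀ x))) :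
    Tendsto (fun n => eLpNorm (f n - f₀) 2 μ) atTop (𝓝 0) := by
  simp only [eLpNorm_eq_lintegral_rpow_enorm_toReal two_ne_zero ENNReal.ofNat_ne_top,
    ENNReal.toReal_ofNat]
  have key : Tendsto (fun n => ∫⁻ x, ‖(f n - f₀) x‖ₑ ^ (2 : ℝ) ∂μ) atTop
      (𝓝 (∫⁻ _, 0 ∂μ)) := by
    refine tendsto_lintegral_of_dominated_convergence' (fun x => ‖g x‖ₑ ^ (2 : ℝ)) (fun n => ?_)
      (fun n => ?_) ?_ ?_
    · exact ((hf n).sub hf₀).enorm.pow_const _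
    · filter_upwards [hle n] with x hx
      refine ENNReal.rpow_le_rpow ?_ zero_le_two
      rw [enorm_le_iff_norm_le]
      exact hx.trans (le_abs_self _)
    · have := lintegral_rpow_enorm_lt_top_of_eLpNorm_lt_top two_ne_zero ENNReal.ofNat_ne_top hg.2
      simpa using this.ne
    · filter_upwards [hlim] with x hx
      have h1 : Tendsto (fun n => ‖f n x - f₀ x‖ₑ) atTop (𝓝 0) := by
        have := (hx.sub_const (f₀ x)).enorm
        simpa using this
      have h2 := (ENNReal.continuous_rpow_const (y := (2 : ℝ))).tendsto 0 |>.comp h1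
      simpa [Function.comp_def] using h2
  have h3 := (ENNReal.continuous_rpow_const (y := (1 / 2 : ℝ))).tendsto 0
  simp only [lintegral_zero] at key
  simpa [Function.comp_def] using h3.comp key

/-- A piecewise linear cutoff, `0` on `(-∞, ε]` and `1` on `[2ε, ∞)`. -/
noncomputable def rampCutoff (ε s : ℝ) : ℝ := max 0 (min 1 ((s - ε) / ε))

/-- The primitive of `rampCutoff ε`, a `C¹` approximation of the positive part. -/
noncomputable def softPosPart (ε t : ℝ) : ℝ := ∫ s in (0 : ℝ)..t, rampCutoff ε s

theorem continuous_rampCutoff (ε : ℝ) : Continuous (rampCutoff ε) := by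
  unfold rampCutoff
  fun_prop

theorem rampCutoff_nonneg (ε s : ℝ) : 0 ≤ rampCutoff ε s := le_max_left _ _

theorem rampCutoff_le_one (ε s : ℝ) : rampCutoff ε s ≤ 1 :=
  max_le zero_le_one (min_le_left _ _)

theorem rampCutoff_of_le {ε s : ℝ} (hε : 0 < ε) (hs : s ≤ ε) : rampCutoff ε s = 0 :=
  max_eq_left ((min_le_right _ _).trans
    (div_nonpos_of_nonpos_of_nonneg (sub_nonpos.2 hs) hε.le))

theorem rampCutoff_of_ge {ε s : ℝ} (hε : 0 < ε) (hs : 2 * ε ≤ s) : rampCutoff ε s = 1 := by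
  have : 1 ≤ (s - ε) / ε := by
    rw [le_div_iff₀ hε]
    linarith
  rw [rampCutoff, min_eq_left this, max_eq_right zero_le_one]

theorem tendsto_rampCutoff {ε : ℕ → ℝ} (hε : ∀ n, 0 < ε n) (hlim : Tendsto ε atTop (𝓝 0)) {s : ℝ}
    (hs : 0 < s) : Tendsto (fun n => rampCutoff (ε n) s) atTop (𝓝 1) := by
  refine tendsto_const_nhds.congr' ?_
  filter_upwards [hlim.eventually (ge_mem_nhds (half_pos hs))] with n hn
  exact (rampCutoff_of_ge (hε n) (by linarith)).symm

theorem hasDerivAt_softPosPart (ε t : ℝ) : HasDerivAt (softPosPart ε) (rampCutoff ε t) t :=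
  (continuous_rampCutoff ε).integral_hasStrictDerivAt 0 t |>.hasDerivAt

theorem contDiff_softPosPart (ε : ℝ) : ContDiff ℝ 1 (softPosPart ε) := by
  refine contDiff_one_iff_deriv.2 ⟨fun t => (hasDerivAt_softPosPart ε t).differentiableAt, ?_⟩
  rw [show deriv (softPosPart ε) = rampCutoff ε from
    funext fun t => (hasDerivAt_softPosPart ε t).deriv]
  exact continuous_rampCutoff ε

theorem softPosPart_nonneg {ε t : ℝ} (ht : 0 ≤ t) : 0 ≤ softPosPart ε t :=
  intervalIntegral.integral_nonneg ht fun _ _ => rampCutoff_nonneg _ _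

theorem softPosPart_le {ε t : ℝ} (ht : 0 ≤ t) : softPosPart ε t ≤ t := by
  have := intervalIntegral.integral_mono_on ht
    (f := rampCutoff ε) (μ := volume) ((continuous_rampCutoff ε).intervalIntegrable 0 t)
    (g := fun _ => (1 : ℝ)) intervalIntegrable_const
    fun s _ => rampCutoff_le_one ε s
  simpa [softPosPart] using this

theorem softPosPart_of_le {ε t : ℝ} (hε : 0 < ε) (ht0 : 0 ≤ t) (ht : t ≤ ε) :
    softPosPart ε t = 0 := by
  rw [softPosPart, intervalIntegral.integral_congr (g := fun _ => 0), intervalIntegral.integral_zero]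
  intro s hs
  rw [uIcc_of_le ht0] at hs
  exact rampCutoff_of_le hε (hs.2.trans ht)

theorem tendsto_softPosPart {ε : ℕ → ℝ} (hε : ∀ n, 0 < ε n) (hlim : Tendsto ε atTop (𝓝 0)) {t : ℝ}
    (ht : 0 < t) : Tendsto (fun n => softPosPart (ε n) t) atTop (𝓝 t) := by
  have h : Tendsto (fun n => softPosPart (ε n) t) atTop (𝓝 (∫ _ in (0 : ℝ)..t, (1 : ℝ))) := by
    refine intervalIntegral.tendsto_integral_filter_of_dominated_convergence (fun _ => 1)
      (.of_forall fun n => (continuous_rampCutoff _).aestronglyMeasurable)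
      (.of_forall fun n => .of_forall fun s _ => ?_) intervalIntegrable_const
      (.of_forall fun s hs => ?_)
    · rw [Real.norm_of_nonneg (rampCutoff_nonneg _ _)]
      exact rampCutoff_le_one _ _
    · rw [uIoc_of_le ht.le] at hs
      exact tendsto_rampCutoff hε hlim hs.1
  simpa using h

theorem eLpNorm_indicator_sub_restrict {α : Type*} [MeasurableSpace α] {μ : Measure α}
    {V Ω : Set α} (hV : MeasurableSet V) (hVΩ : V ⊆ Ω) {F : Type*} [NormedAddCommGroup F]
    (f g : α → F) :
    eLpNorm (V.indicator f - V.indicator g) 2 (μ.restrict Ω) = eLpNorm (f - g) 2 (μ.restrict V) := by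
  rw [← Set.indicator_sub', eLpNorm_indicator_eq_eLpNorm_restrict hV, Measure.restrict_restrict hV,
    inter_eq_left.2 hVΩ]

/-! ### Positive parts of classical functions in `H¹₀`, without boundary regularity. -/

namespace PartialSymmetry

variable {N : ℕ}

local notation "E" => EuclideanSpace ℝ (Fin N)

variable {Ω : Set (EuclideanSpace ℝ (Fin N))}

section Positive

variable {V : Set (EuclideanSpace ℝ (Fin N))} {W : EuclideanSpace ℝ (Fin N) → ℝ}

theorem isCompact_superlevel (hVb : Bornology.IsBounded V) (hWc : ContinuousOn W (closure V))
    (ε : ℝ) : IsCompact (closure V ∩ W ⁻¹' Ici ε) :=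
  hVb.isCompact_closure.of_isClosed_subset
    (hWc.preimage_isClosed_of_isClosed isClosed_closure isClosed_Ici) inter_subset_left

/-- Zero boundary values keep the set `W ≥ ε` away from the boundary. This takes the place of any
regularity of `∂V`. -/
theorem superlevel_subset (hV : IsOpen V) (hW0 : ∀ x ∈ frontier V, W x = 0) {ε : ℝ} (hε : 0 < ε) :
    closure V ∩ W ⁻¹' Ici ε ⊆ V := by
  rintro x ⟨hx, hxW⟩
  by_contra hxV
  have : x ∈ frontier V := by
    rw [hV.frontier_eq]
    exact ⟨hx, hxV⟩
  have h0 := hW0 x this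
  have : ε ≤ W x := hxW
  linarith

theorem indicator_softPosPart_eq_zero (hWpos : ∀ x ∈ V, 0 < W x) {ε : ℝ} (hε : 0 < ε) {x : E}
    (hx : x ∉ closure V ∩ W ⁻¹' Ici ε) : V.indicator (fun x => softPosPart ε (W x)) x = 0 := by
  by_cases hxV : x ∈ V
  · rw [indicator_of_mem hxV]
    have : ¬ ε ≤ W x := fun h => hx ⟨subset_closure hxV, h⟩
    exact softPosPart_of_le hε (hWpos x hxV).le (not_le.1 this).le
  · exact indicator_of_notMem hxV _

theorem tsupport_indicator_softPosPart (hWc : ContinuousOn W (closure V))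
    (hWpos : ∀ x ∈ V, 0 < W x) {ε : ℝ} (hε : 0 < ε) :
    tsupport (V.indicator fun x => softPosPart ε (W x)) ⊆ closure V ∩ W ⁻¹' Ici ε := by
  refine closure_minimal (fun x hx => ?_)
    (hWc.preimage_isClosed_of_isClosed isClosed_closure isClosed_Ici)
  by_contra h
  exact hx (indicator_softPosPart_eq_zero hWpos hε h)

/-- In `V` this is a composition; a point outside `V` has a neighbourhood missing the closed set `W
≥ ε`, on which the function is zero. -/
theorem contDiff_indicator_softPosPart (hV : IsOpen V) (hW : ContDiffOn ℝ 2 W V)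
    (hWc : ContinuousOn W (closure V)) (hWpos : ∀ x ∈ V, 0 < W x)
    (hW0 : ∀ x ∈ frontier V, W x = 0) {ε : ℝ} (hε : 0 < ε) :
    ContDiff ℝ 1 (V.indicator fun x => softPosPart ε (W x)) := by
  rw [contDiff_iff_contDiffAt]
  intro x
  by_cases hx : x ∈ V
  · have h1 : ContDiffAt ℝ 1 (fun x => softPosPart ε (W x)) x :=
      (contDiff_softPosPart ε).contDiffAt.comp x
        ((hW.contDiffAt (hV.mem_nhds hx)).of_le one_le_two)
    refine h1.congr_of_eventuallyEq ?_
    filter_upwards [hV.mem_nhds hx] with y hy using indicator_of_mem hy _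
  · have hcl : IsClosed (closure V ∩ W ⁻¹' Ici ε) :=
      hWc.preimage_isClosed_of_isClosed isClosed_closure isClosed_Ici
    have hx' : x ∉ closure V ∩ W ⁻¹' Ici ε := fun h => hx (superlevel_subset hV hW0 hε h)
    refine (contDiffAt_const (c := (0 : ℝ))).congr_of_eventuallyEq ?_
    filter_upwards [hcl.isOpen_compl.mem_nhds hx'] with y hy
    exact indicator_softPosPart_eq_zero hWpos hε hy

theorem gradient_indicator_softPosPart (hV : IsOpen V) (hW : ContDiffOn ℝ 2 W V)
    (hWc : ContinuousOn W (closure V)) (hWpos : ∀ x ∈ V, 0 < W x)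
    (hW0 : ∀ x ∈ frontier V, W x = 0) {ε : ℝ} (hε : 0 < ε) :
    gradient (V.indicator fun x => softPosPart ε (W x))
      = V.indicator fun x => rampCutoff ε (W x) • gradient W x := by
  funext x
  by_cases hx : x ∈ V
  · rw [indicator_of_mem hx]
    have hWd : HasFDerivAt W (fderiv ℝ W x) x :=
      ((hW.differentiableOn two_ne_zero x hx).differentiableAt (hV.mem_nhds hx)).hasFDerivAt
    have h1 : HasFDerivAt (fun x => softPosPart ε (W x)) (rampCutoff ε (W x) • fderiv ℝ W x) x :=
      (hasDerivAt_softPosPart ε (W x)).comp_hasFDerivAt x hWd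
    have h2 : HasFDerivAt (V.indicator fun x => softPosPart ε (W x))
        (rampCutoff ε (W x) • fderiv ℝ W x) x := by
      refine h1.congr_of_eventuallyEq ?_
      filter_upwards [hV.mem_nhds hx] with y hy using indicator_of_mem hy _
    rw [gradient, h2.fderiv, gradient]
    simp
  · rw [indicator_of_notMem hx]
    refine gradient_eq_zero_of_notMem_tsupport fun h => hx ?_
    exact superlevel_subset hV hW0 hε (tsupport_indicator_softPosPart hWc hWpos hε h)

/-- A function `W ∈ C²(V) ∩ C(closure V)` with bounded Laplacian that is positive in `V` and vanishes
on `∂V` belongs, extended by zero, to `H¹₀`, with the extension by zero of `∇W` as its gradient. -/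
theorem isH10Pair_indicator_of_pos (hV : IsOpen V) (hΩ : IsOpen Ω) (hVΩ : V ⊆ Ω)
    (hΩb : Bornology.IsBounded Ω) (hW : ContDiffOn ℝ 2 W V)
    (hWc : ContinuousOn W (closure V)) (hWpos : ∀ x ∈ V, 0 < W x)
    (hW0 : ∀ x ∈ frontier V, W x = 0) {K : ℝ} (hK : ∀ x ∈ V, |(Δ W : E → ℝ) x| ≤ K) :
    IsH10Pair Ω (V.indicator W) (V.indicator (gradient W)) ∧
      ∫ x in V, ‖gradient W x‖ ^ 2 = ∫ x in V, -(Δ W : E → ℝ) x * W x := by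
  have hVb := hΩb.subset hVΩ
  have hVfin : volume V ≠ ⊤ := hVb.measure_lt_top.ne
  have hΩfin : volume Ω ≠ ⊤ := hΩb.measure_lt_top.ne
  have : IsFiniteMeasure (volume.restrict V) := ⟨by simpa [lt_top_iff_ne_top] using hVfin⟩
  have hVm := hV.measurableSet
  obtain ⟨M, hM⟩ := hVb.isCompact_closure.exists_bound_of_continuousOn hWc
  have hMV : ∀ x ∈ V, W x ≤ M := fun x hx => (le_abs_self _).trans (hM x (subset_closure hx))
  set ε : ℕ → ℝ := fun n => 1 / ((n : ℝ) + 1)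
  have hε : ∀ n, 0 < ε n := fun n => Nat.one_div_pos_of_nat
  have hεlim : Tendsto ε atTop (𝓝 0) := tendsto_one_div_add_atTop_nhds_zero_nat
  have hWcV : ContinuousOn W V := hWc.mono subset_closure
  have hgc : ContinuousOn (gradient W) V :=
    continuousOn_gradient hV (hW.of_le one_le_two)
  have hΔc : ContinuousOn (Δ W : E → ℝ) V := continuousOn_laplacian hV hW
  have hcut : ∀ n, ContinuousOn (fun x => rampCutoff (ε n) (W x)) V := fun n =>
    (continuous_rampCutoff _).comp_continuousOn hWcV
  have hsoft : ∀ n, ContinuousOn (fun x => softPosPart (ε n) (W x)) V := fun n =>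
    (contDiff_softPosPart _).continuous.comp_continuousOn hWcV
  have hgm : AEStronglyMeasurable (gradient W) (volume.restrict V) := hgc.aestronglyMeasurable hVm
  have hpos : ∀ᵐ x ∂volume.restrict V, x ∈ V := ae_restrict_mem hVm
  -- the energy identity for the approximations
  have green : ∀ n, ∫ x in V, rampCutoff (ε n) (W x) * ‖gradient W x‖ ^ 2
      = ∫ x in V, -(Δ W : E → ℝ) x * softPosPart (ε n) (W x) := by
    intro n
    have hts := tsupport_indicator_softPosPart hWc hWpos (hε n)
    have h := setIntegral_inner_gradient hV hW
      (contDiff_indicator_softPosPart hV hW hWc hWpos hW0 (hε n))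
      ((isCompact_superlevel hVb hWc (ε n)).of_isClosed_subset (isClosed_tsupport _) hts)
      (hts.trans (superlevel_subset hV hW0 (hε n)))
    rw [gradient_indicator_softPosPart hV hW hWc hWpos hW0 (hε n)] at h
    have e1 := setIntegral_congr_fun (μ := volume) hVm
      (f := fun x => inner ℝ (gradient W x)
        (V.indicator (fun x => rampCutoff (ε n) (W x) • gradient W x) x))
      (g := fun x => rampCutoff (ε n) (W x) * ‖gradient W x‖ ^ 2) fun x hx => by
        simp only [indicator_of_mem hx, inner_smul_right, real_inner_self_eq_norm_sq]
    have e2 := setIntegral_congr_fun (μ := volume) hVm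
      (f := fun x => -(Δ W : E → ℝ) x * V.indicator (fun x => softPosPart (ε n) (W x)) x)
      (g := fun x => -(Δ W : E → ℝ) x * softPosPart (ε n) (W x)) fun x hx => by
        simp only [indicator_of_mem hx]
    rw [← e1, ← e2]
    exact h
  have hI2 : ∀ n, ∀ᵐ x ∂volume.restrict V,
      ‖-(Δ W : E → ℝ) x * softPosPart (ε n) (W x)‖ ≤ K * M := by
    intro n
    filter_upwards [hpos] with x hx
    rw [norm_mul, norm_neg]
    have h0 := softPosPart_nonneg (ε := ε n) (hWpos x hx).le
    rw [Real.norm_of_nonneg h0]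
    exact mul_le_mul (hK x hx) ((softPosPart_le (hWpos x hx).le).trans (hMV x hx)) h0
      ((abs_nonneg _).trans (hK x hx))
  have hm2 : ∀ n, AEStronglyMeasurable (fun x => -(Δ W : E → ℝ) x * softPosPart (ε n) (W x))
      (volume.restrict V) := fun n => (hΔc.neg.mul (hsoft n)).aestronglyMeasurable hVm
  have hm1 : ∀ n, AEStronglyMeasurable (fun x => rampCutoff (ε n) (W x) * ‖gradient W x‖ ^ 2)
      (volume.restrict V) := fun n => ((hcut n).mul (hgc.norm.pow 2)).aestronglyMeasurable hVm
  have hlim1 : ∀ᵐ x ∂volume.restrict V, Tendsto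
      (fun n => rampCutoff (ε n) (W x) * ‖gradient W x‖ ^ 2) atTop (𝓝 (‖gradient W x‖ ^ 2)) := by
    filter_upwards [hpos] with x hx
    simpa using (tendsto_rampCutoff hε hεlim (hWpos x hx)).mul_const (‖gradient W x‖ ^ 2)
  have hlim2 : Tendsto (fun n => ∫ x in V, -(Δ W : E → ℝ) x * softPosPart (ε n) (W x)) atTop
      (𝓝 (∫ x in V, -(Δ W : E → ℝ) x * W x)) := by
    refine tendsto_integral_of_dominated_convergence (fun _ => K * M) hm2 (integrable_const _) hI2 ?_
    filter_upwards [hpos] with x hx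
    exact (tendsto_softPosPart hε hεlim (hWpos x hx)).const_mul _
  -- the approximating functions and their gradients
  have hpair : ∀ n, IsH10Pair Ω (V.indicator fun x => softPosPart (ε n) (W x))
      (V.indicator fun x => rampCutoff (ε n) (W x) • gradient W x) := by
    intro n
    have hts := tsupport_indicator_softPosPart hWc hWpos (hε n)
    have h := IsH10Pair.of_contDiff_one hΩ hΩfin
      (contDiff_indicator_softPosPart hV hW hWc hWpos hW0 (hε n))
      ((isCompact_superlevel hVb hWc (ε n)).of_isClosed_subset (isClosed_tsupport _) hts)
      ((hts.trans (superlevel_subset hV hW0 (hε n))).trans hVΩ)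
    rwa [gradient_indicator_softPosPart hV hW hWc hWpos hW0 (hε n)] at h
  have hres : (volume.restrict Ω).restrict V = volume.restrict V := by
    rw [Measure.restrict_restrict hVm, inter_eq_left.2 hVΩ]
  -- Square integrability of `∇W` is not yet known here. The cutoff vanishes off a compact
  -- superlevel set inside `V`, on which the integrand is continuous.
  have hI1 : ∀ n, Integrable (fun x => rampCutoff (ε n) (W x) * ‖gradient W x‖ ^ 2)
      (volume.restrict V) := by
    intro n
    have hts := isCompact_superlevel hVb hWc (ε n)
    have hb : IntegrableOn (fun x => rampCutoff (ε n) (W x) * ‖gradient W x‖ ^ 2)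
        (closure V ∩ W ⁻¹' Ici (ε n)) :=
      (((hcut n).mul (hgc.norm.pow 2)).mono (superlevel_subset hV hW0 (hε n))).integrableOn_compact
        hts
    refine (hb.of_forall_sdiff_eq_zero hVm fun x hx => ?_)
    have : ¬ ε n ≤ W x := fun h => hx.2 ⟨subset_closure hx.1, h⟩
    rw [rampCutoff_of_le (hε n) (not_le.1 this).le, zero_mul]
  -- Fatou's lemma
  have hfatou : ∫⁻ x in V, ENNReal.ofReal (‖gradient W x‖ ^ 2)
      ≤ ENNReal.ofReal (∫ x in V, -(Δ W : E → ℝ) x * W x) := by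
    calc ∫⁻ x in V, ENNReal.ofReal (‖gradient W x‖ ^ 2)
        = ∫⁻ x in V, liminf (fun n => ENNReal.ofReal (rampCutoff (ε n) (W x) *
            ‖gradient W x‖ ^ 2)) atTop := by
          refine lintegral_congr_ae ?_
          filter_upwards [hlim1] with x hx
          exact ((ENNReal.tendsto_ofReal hx).liminf_eq).symm
      _ ≤ liminf (fun n => ∫⁻ x in V, ENNReal.ofReal (rampCutoff (ε n) (W x) *
            ‖gradient W x‖ ^ 2)) atTop :=
          lintegral_liminf_le' fun n => (hm1 n).aemeasurable.ennreal_ofReal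
      _ = liminf (fun n => ENNReal.ofReal
            (∫ x in V, -(Δ W : E → ℝ) x * softPosPart (ε n) (W x))) atTop := by
          congr 1
          funext n
          rw [← green n, ofReal_integral_eq_lintegral_ofReal (hI1 n)]
          exact .of_forall fun x => mul_nonneg (rampCutoff_nonneg _ _) (sq_nonneg _)
      _ = ENNReal.ofReal (∫ x in V, -(Δ W : E → ℝ) x * W x) :=
          (ENNReal.tendsto_ofReal hlim2).liminf_eq
  have hsq : Integrable (fun x => ‖gradient W x‖ ^ 2) (volume.restrict V) := by
    refine ⟨hgm.norm.pow 2, ?_⟩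
    rw [hasFiniteIntegral_iff_ofReal (.of_forall fun x => sq_nonneg _)]
    exact hfatou.trans_lt ENNReal.ofReal_lt_top
  have hgL2 : MemLp (gradient W) 2 (volume.restrict V) :=
    (memLp_two_iff_integrable_sq_norm hgm).2 hsq
  have hcl : ∀ n x, |rampCutoff (ε n) x - 1| ≤ 1 := fun n x => by
    rw [abs_le]
    constructor <;> linarith [rampCutoff_nonneg (ε n) x, rampCutoff_le_one (ε n) x]
  refine ⟨IsH10Pair.of_tendsto hpair ?_ ?_ ?_ ?_, ?_⟩
  · rw [memLp_indicator_iff_restrict hVm, hres]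
    exact MemLp.of_bound (hWcV.aestronglyMeasurable hVm) M
      (hpos.mono fun x hx => hM x (subset_closure hx))
  · rw [memLp_indicator_iff_restrict hVm, hres]
    exact hgL2
  · simp only [eLpNorm_indicator_sub_restrict hVm hVΩ]
    refine tendsto_eLpNorm_two_of_dominated (g := fun _ => M)
      (fun n => (hsoft n).aestronglyMeasurable hVm) (hWcV.aestronglyMeasurable hVm)
      (memLp_const M) (fun n => hpos.mono fun x hx => ?_) (hpos.mono fun x hx => ?_)
    · have h0 := softPosPart_nonneg (ε := ε n) (hWpos x hx).le
      have h1 := softPosPart_le (ε := ε n) (hWpos x hx).le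
      rw [Real.norm_eq_abs, abs_le]
      constructor <;> linarith [hMV x hx, hWpos x hx]
    · exact tendsto_softPosPart hε hεlim (hWpos x hx)
  · simp only [eLpNorm_indicator_sub_restrict hVm hVΩ]
    refine tendsto_eLpNorm_two_of_dominated (g := fun x => ‖gradient W x‖)
      (fun n => ((hcut n).smul hgc).aestronglyMeasurable hVm) hgm hgL2.norm
      (fun n => .of_forall fun x => ?_) (hpos.mono fun x hx => ?_)
    · have : rampCutoff (ε n) (W x) • gradient W x - gradient W x
          = (rampCutoff (ε n) (W x) - 1) • gradient W x := by rw [sub_smul, one_smul]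
      rw [this, norm_smul]
      exact mul_le_of_le_one_left (norm_nonneg _) (hcl n _)
    · simpa using (tendsto_rampCutoff hε hεlim (hWpos x hx)).smul_const (gradient W x)
  · have hlim3 : Tendsto (fun n => ∫ x in V, rampCutoff (ε n) (W x) * ‖gradient W x‖ ^ 2) atTop
        (𝓝 (∫ x in V, ‖gradient W x‖ ^ 2)) := by
      refine tendsto_integral_of_dominated_convergence (fun x => ‖gradient W x‖ ^ 2) hm1 hsq
        (fun n => .of_forall fun x => ?_) hlim1
      rw [Real.norm_of_nonneg (mul_nonneg (rampCutoff_nonneg _ _) (sq_nonneg _))]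
      exact mul_le_of_le_one_left (sq_nonneg _) (rampCutoff_le_one _ _)
    exact tendsto_nhds_unique hlim3 (hlim2.congr fun n => (green n).symm)

end Positive

/-- The case of a positive function is applied on `V = U ∩ {W > 0}`: a boundary point of `V` either
lies in `U`, where `W ≥ 0` by closure and `W > 0` would put it into `V`, or lies on `∂U`. The
integral identity is `-ΔW` tested with `W⁺`. -/
theorem isH10Pair_posPart {U : Set (EuclideanSpace ℝ (Fin N))}
    {W : EuclideanSpace ℝ (Fin N) → ℝ} (hU : IsOpen U) (hΩ : IsOpen Ω) (hUΩ : U ⊆ Ω)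
    (hΩb : Bornology.IsBounded Ω) (hW : ContDiffOn ℝ 2 W U)
    (hWc : ContinuousOn W (closure U)) (hW0 : ∀ x ∈ frontier U, W x = 0)
    {K : ℝ} (hK : ∀ x ∈ U, |(Δ W : E → ℝ) x| ≤ K) :
    IsH10Pair Ω (U.indicator fun x => max (W x) 0)
        ((U ∩ {x | 0 < W x}).indicator (gradient W)) ∧
      ∫ x in Ω, ‖(U ∩ {x | 0 < W x}).indicator (gradient W) x‖ ^ 2
        = ∫ x in Ω, -(Δ W : E → ℝ) x * U.indicator (fun x => max (W x) 0) x := by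
  set V := U ∩ {x | 0 < W x}
  have hVU : V ⊆ U := inter_subset_left
  have hV : IsOpen V := (hWc.mono subset_closure).isOpen_inter_preimage hU isOpen_Ioi
  have hcl : closure V ⊆ closure U := closure_mono hVU
  have hW0' : ∀ x ∈ frontier V, W x = 0 := by
    intro x hx
    rw [hV.frontier_eq] at hx
    have hge : 0 ≤ W x := by
      have hc : IsClosed (closure U ∩ W ⁻¹' Ici 0) :=
        hWc.preimage_isClosed_of_isClosed isClosed_closure isClosed_Ici
      have hsub : V ⊆ closure U ∩ W ⁻¹' Ici 0 := fun y hy =>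
        ⟨subset_closure hy.1, mem_preimage.2 (le_of_lt (show 0 < W y from hy.2))⟩
      exact (closure_minimal hsub hc hx.1).2
    by_cases hxU : x ∈ U
    · by_contra hne
      exact hx.2 ⟨hxU, lt_of_le_of_ne hge (Ne.symm hne)⟩
    · refine hW0 x ?_
      rw [hU.frontier_eq]
      exact ⟨hcl hx.1, hxU⟩
  have e : (U.indicator fun x => max (W x) 0) = V.indicator W := by
    funext x
    by_cases hxU : x ∈ U
    · by_cases hxW : 0 < W x
      · rw [indicator_of_mem hxU, indicator_of_mem (show x ∈ V from ⟨hxU, hxW⟩),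
          max_eq_left hxW.le]
      · rw [indicator_of_mem hxU, indicator_of_notMem (fun h : x ∈ V => hxW h.2),
          max_eq_right (not_lt.1 hxW)]
    · rw [indicator_of_notMem hxU, indicator_of_notMem fun h : x ∈ V => hxU h.1]
  obtain ⟨h1, h2⟩ := isH10Pair_indicator_of_pos hV hΩ (hVU.trans hUΩ) hΩb (hW.mono hVU)
    (hWc.mono hcl) (fun x hx => hx.2) hW0' (fun x hx => hK x (hVU hx))
  rw [e]
  refine ⟨h1, ?_⟩
  have hr : ∀ g : E → ℝ, ∫ x in Ω, V.indicator g x = ∫ x in V, g x := fun g => by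
    rw [setIntegral_indicator hV.measurableSet, inter_eq_right.2 (hVU.trans hUΩ)]
  rw [← hr, ← hr] at h2
  convert h2 using 3 with x x
  · by_cases hx : x ∈ V <;> simp [hx]
  · by_cases hx : x ∈ V <;> simp [hx]

end PartialSymmetry

/-! ### Measurability of superpositions with Carathéodory functions. -/

section Caratheodory

variable {α : Type*} [MeasurableSpace α] {μ : Measure α} {f : α → ℝ → ℝ}

/-- A Carathéodory function has a jointly measurable modification. -/
theorem exists_measurable_uncurry_ae_eq (hm : ∀ t, AEMeasurable (fun x => f x t) μ)
    (hc : ∀ᵐ x ∂μ, Continuous (f x)) :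
    ∃ g : α → ℝ → ℝ, Measurable (Function.uncurry g) ∧ (∀ x, Continuous (g x)) ∧
      ∀ᵐ x ∂μ, g x = f x := by
  -- By continuity in `t` the rational values of `t` decide everything, so only countably many null
  -- sets have to be discarded.
  have hgood : ∀ᵐ x ∂μ, Continuous (f x) ∧ ∀ q : ℚ, f x q = (hm q).mk _ x :=
    hc.and (ae_all_iff.2 fun q => (hm q).ae_eq_mk)
  set t := toMeasurable μ {x | ¬(Continuous (f x) ∧ ∀ q : ℚ, f x q = (hm q).mk _ x)}
  have ht : MeasurableSet t := measurableSet_toMeasurable _ _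
  have ht0 : μ t = 0 := by
    rw [measure_toMeasurable]
    exact hgood
  have htg : ∀ x ∉ t, Continuous (f x) ∧ ∀ q : ℚ, f x q = (hm q).mk _ x := fun x hx => by
    by_contra h
    exact hx (subset_toMeasurable _ _ h)
  set g : α → ℝ → ℝ := fun x s => tᶜ.indicator (fun x => f x s) x
  have hgc : ∀ x, Continuous (g x) := by
    intro x
    by_cases hx : x ∈ t
    · have : g x = fun _ => 0 := funext fun s => indicator_of_notMem (by simpa using hx) _
      rw [this]
      exact continuous_const
    · have : g x = f x := funext fun s => indicator_of_mem (by simpa using hx) _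
      rw [this]
      exact (htg x hx).1
  have hgq : ∀ q : ℚ, Measurable fun x => g x q := by
    intro q
    have : (fun x => g x q) = tᶜ.indicator ((hm q).mk _) := by
      funext x
      by_cases hx : x ∈ t
      · simp [g, hx]
      · simp only [g, indicator_of_mem (show x ∈ tᶜ from hx)]
        exact (htg x hx).2 q
    rw [this]
    exact (hm q).measurable_mk.indicator ht.compl
  have hgm : ∀ s, Measurable fun x => g x s := by
    intro s
    obtain ⟨r, hr, hlim⟩ := mem_closure_iff_seq_limit.1 (Rat.denseRange_cast (𝕜 := ℝ) s)
    refine measurable_of_tendsto_metrizable (f := fun n x => g x (r n)) (fun n => ?_) ?_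
    · obtain ⟨q, hq⟩ := hr n
      rw [← hq]
      exact hgq q
    · exact tendsto_pi_nhds.2 fun x => ((hgc x).tendsto s).comp hlim
  refine ⟨g, ?_, hgc, ?_⟩
  · have := measurable_uncurry_of_continuous_of_measurable (u := fun s x => g x s) hgc hgm
    exact this.comp measurable_swap
  · filter_upwards [compl_mem_ae_iff.2 ht0] with x hx
    exact funext fun s => indicator_of_mem hx _

theorem aemeasurable_superposition (hm : ∀ t, AEMeasurable (fun x => f x t) μ)
    (hc : ∀ᵐ x ∂μ, Continuous (f x)) {u : α → ℝ} (hu : AEMeasurable u μ) :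
    AEMeasurable (fun x => f x (u x)) μ := by
  obtain ⟨g, hg, -, hgf⟩ := exists_measurable_uncurry_ae_eq hm hc
  refine (hg.comp_aemeasurable (aemeasurable_id.prodMk hu)).congr ?_
  filter_upwards [hgf] with x hx
  simp [hx]

theorem aemeasurable_intervalIntegral_superposition (hm : ∀ t, AEMeasurable (fun x => f x t) μ)
    (hc : ∀ᵐ x ∂μ, Continuous (f x)) {u : α → ℝ} (hu : AEMeasurable u μ) :
    AEMeasurable (fun x => ∫ s in (0 : ℝ)..(u x), f x s) μ := by
  obtain ⟨g, hg, hgc, hgf⟩ := exists_measurable_uncurry_ae_eq hm hc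
  -- The primitive is continuous in its endpoint and measurable in `x`, hence jointly measurable.
  have hP : Measurable (Function.uncurry fun (t : ℝ) (x : α) => ∫ s in (0 : ℝ)..t, g x s) := by
    refine measurable_uncurry_of_continuous_of_measurable (fun x => ?_) fun t => ?_
    · exact intervalIntegral.continuous_primitive (fun a b => (hgc x).intervalIntegrable a b) 0
    · simp only [intervalIntegral]
      exact (hg.stronglyMeasurable.integral_prod_right.sub
        hg.stronglyMeasurable.integral_prod_right).measurable
  refine (hP.comp_aemeasurable (hu.prodMk aemeasurable_id)).congr ?_
  filter_upwards [hgf] with x hx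
  simp [hx]

end Caratheodory

/-! ### Secant inequalities for convex functions of one variable. -/

section Convex

theorem intervalIntegral_affine (a b s : ℝ) :
    ∫ τ in (0 : ℝ)..s, (a + τ * b) = s * a + s ^ 2 / 2 * b := by
  have h : IntervalIntegrable (fun τ : ℝ => τ * b) volume 0 s :=
    (continuous_id.mul continuous_const).intervalIntegrable _ _
  rw [intervalIntegral.integral_add intervalIntegrable_const h,
    intervalIntegral.integral_mul_const]
  simp

/-- The secant inequality behind the sign of the shifted energy. -/
theorem secant_quadratic_le_integral {g : ℝ → ℝ} (hg : Continuous g)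
    (hconv : ConvexOn ℝ (Icc (-1) 1) g) {s : ℝ} (hs : s ∈ Icc (-1 : ℝ) 1) :
    s * g 0 + s ^ 2 / 2 * (g 0 - g (-1)) ≤ ∫ τ in (0 : ℝ)..s, g τ := by
  have hc : Continuous fun τ : ℝ => g 0 + τ * (g 0 - g (-1)) := by fun_prop
  have hm1 : (-1 : ℝ) ∈ Icc (-1 : ℝ) 1 := by norm_num
  have h0 : (0 : ℝ) ∈ Icc (-1 : ℝ) 1 := by norm_num
  rw [← intervalIntegral_affine]
  -- The left side integrates the line through the graph at `-1` and `0`. Right of `0` the graph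
  -- lies above that line; on `[-1, 0]` it lies below, but there the integral runs backwards.
  rcases le_total 0 s with h | h
  · refine intervalIntegral.integral_mono_on h (hc.intervalIntegrable _ _)
      (hg.intervalIntegrable _ _) fun τ hτ => ?_
    rcases hτ.1.eq_or_lt with h' | h'
    · simp [← h']
    · have := hconv.slope_mono_adjacent hm1 ⟨by linarith, hτ.2.trans hs.2⟩
        (by norm_num : (-1 : ℝ) < 0) h'
      simp only [sub_neg_eq_add, zero_add, div_one, sub_zero] at this
      rw [le_div_iff₀ h'] at this
      linarith
  · rw [intervalIntegral.integral_symm s 0, intervalIntegral.integral_symm s 0, neg_le_neg_iff]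
    refine intervalIntegral.integral_mono_on h (hg.intervalIntegrable _ _)
      (hc.intervalIntegrable _ _) fun τ hτ => ?_
    have := hconv.2 hm1 h0 (neg_nonneg.2 hτ.2) (by linarith [hτ.1, hs.1] : 0 ≤ 1 + τ) (by ring)
    simp only [smul_eq_mul, mul_zero, add_zero, mul_neg, mul_one, neg_neg] at this
    linarith

theorem secant_quadratic_lt_integral {g : ℝ → ℝ} (hg : Continuous g)
    (hconv : ConvexOn ℝ (Icc (-1) 1) g) (hstrict : StrictConvexOn ℝ (Icc (-1) 0) g) {s : ℝ}
    (hs : s ∈ Icc (-1 : ℝ) 1) (hs0 : s ≠ 0) :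
    s * g 0 + s ^ 2 / 2 * (g 0 - g (-1)) < ∫ τ in (0 : ℝ)..s, g τ := by
  have hc : Continuous fun τ : ℝ => g 0 + τ * (g 0 - g (-1)) := by fun_prop
  have hm1 : (-1 : ℝ) ∈ Icc (-1 : ℝ) 0 := by norm_num
  have h0 : (0 : ℝ) ∈ Icc (-1 : ℝ) 0 := by norm_num
  -- strict secant inequality on the left
  have hleft : ∀ τ, -1 < τ → τ < 0 → g τ < g 0 + τ * (g 0 - g (-1)) := by
    intro τ h1 h2
    have := hstrict.2 hm1 h0 (by norm_num) (neg_pos.2 h2) (by linarith : 0 < 1 + τ) (by ring)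
    simp only [smul_eq_mul, mul_zero, add_zero, mul_neg, mul_one, neg_neg] at this
    linarith
  -- and its extension to the right
  have hright : ∀ τ, 0 < τ → τ ≤ 1 → g 0 + τ * (g 0 - g (-1)) < g τ := by
    intro τ h1 h2
    -- Strict convexity is available only on `[-1, 0]`. At the interior point `-1/2` it makes the
    -- slope up to `0` exceed that of the chord from `-1`, and ordinary convexity carries this slope
    -- to the right.
    have hh := hleft (-1 / 2) (by norm_num) (by norm_num)
    have := hconv.slope_mono_adjacent (x := -1 / 2) (y := 0) (z := τ) ⟨by norm_num, by norm_num⟩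
      ⟨by linarith, h2⟩ (by norm_num) h1
    rw [div_le_div_iff₀ (by norm_num) (by linarith)] at this
    nlinarith
  rw [← intervalIntegral_affine]
  rcases lt_or_gt_of_ne hs0 with h | h
  · rw [intervalIntegral.integral_symm s 0, intervalIntegral.integral_symm s 0, neg_lt_neg_iff]
    refine intervalIntegral.integral_lt_integral_of_continuousOn_of_le_of_exists_lt h
      hg.continuousOn hc.continuousOn (fun τ hτ => ?_) ⟨s / 2, ⟨by linarith, by linarith⟩,
        hleft _ (by linarith [hs.1]) (by linarith)⟩
    rcases hτ.2.eq_or_lt with h' | h'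
    · simp [h']
    · exact (hleft τ (by linarith [hs.1, hτ.1]) h').le
  · exact intervalIntegral.integral_lt_integral_of_continuousOn_of_le_of_exists_lt h
      hc.continuousOn hg.continuousOn (fun τ hτ => (hright τ hτ.1 (hτ.2.trans hs.2)).le)
      ⟨s, ⟨h.le, le_rfl⟩, hright s h hs.2⟩

theorem StrictConvexOn.comp_add_mul {g : ℝ → ℝ} {A B : Set ℝ} (hg : StrictConvexOn ℝ B g)
    (hA : Convex ℝ A) {a v : ℝ} (hv : v ≠ 0) (hAB : ∀ z ∈ A, a + v * z ∈ B) :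
    StrictConvexOn ℝ A fun τ => g (a + v * τ) := by
  refine ⟨hA, fun x hx y hy hxy p q hp hq hpq => ?_⟩
  have := hg.2 (hAB x hx) (hAB y hy) (fun h => hxy (mul_left_cancel₀ hv (add_left_cancel h)))
    hp hq hpq
  simp only [smul_eq_mul] at this ⊢
  convert this using 2
  linear_combination (-a) * hpq

theorem ConvexOn.comp_add_mul {g : ℝ → ℝ} {A B : Set ℝ} (hg : ConvexOn ℝ B g)
    (hA : Convex ℝ A) {a v : ℝ} (hAB : ∀ z ∈ A, a + v * z ∈ B) :
    ConvexOn ℝ A fun τ => g (a + v * τ) := by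
  refine ⟨hA, fun x hx y hy p q hp hq hpq => ?_⟩
  have := hg.2 (hAB x hx) (hAB y hy) hp hq hpq
  simp only [smul_eq_mul] at this ⊢
  convert this using 2
  linear_combination (-a) * hpq

theorem intervalIntegral_comp_add_mul_scaled (g : ℝ → ℝ) (a v s : ℝ) :
    ∫ τ in a..(a + s * v), g τ = v * ∫ τ in (0 : ℝ)..s, g (a + v * τ) := by
  rw [intervalIntegral.mul_integral_comp_add_mul]
  simp [mul_comm]

/-- The secant inequality on an interval `[a - v, a + v]`. -/
theorem secant_quadratic_le_integral_scaled {g : ℝ → ℝ} (hg : Continuous g) {a v : ℝ}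
    (hv : 0 < v) (hconv : ConvexOn ℝ (Icc (a - v) (a + v)) g) {s : ℝ} (hs : s ∈ Icc (-1 : ℝ) 1) :
    s * v * g a + s ^ 2 / 2 * (v * (g a - g (a - v))) ≤ ∫ τ in a..(a + s * v), g τ := by
  have hc := hconv.comp_add_mul (A := Icc (-1) 1) (a := a) (v := v) (convex_Icc _ _) fun z hz =>
    ⟨by nlinarith [hz.1], by nlinarith [hz.2]⟩
  have hcont : Continuous fun τ => g (a + v * τ) := by fun_prop
  have := secant_quadratic_le_integral hcont hc hs
  simp only [mul_zero, add_zero, mul_neg, mul_one, ← sub_eq_add_neg] at this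
  rw [intervalIntegral_comp_add_mul_scaled]
  calc _ = v * (s * g a + s ^ 2 / 2 * (g a - g (a - v))) := by ring
    _ ≤ _ := mul_le_mul_of_nonneg_left this hv.le

theorem secant_quadratic_lt_integral_scaled {g : ℝ → ℝ} (hg : Continuous g) {a v : ℝ}
    (hv : 0 < v) (hconv : ConvexOn ℝ (Icc (a - v) (a + v)) g)
    (hstrict : StrictConvexOn ℝ (Icc (a - v) a) g) {s : ℝ} (hs : s ∈ Icc (-1 : ℝ) 1)
    (hs0 : s ≠ 0) :
    s * v * g a + s ^ 2 / 2 * (v * (g a - g (a - v))) < ∫ τ in a..(a + s * v), g τ := by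
  have hc := hconv.comp_add_mul (A := Icc (-1) 1) (a := a) (v := v) (convex_Icc _ _) fun z hz =>
    ⟨by nlinarith [hz.1], by nlinarith [hz.2]⟩
  have hsc := hstrict.comp_add_mul (A := Icc (-1) 0) (a := a) (v := v) (convex_Icc _ _) hv.ne'
    fun z hz => ⟨by nlinarith [hz.1], by nlinarith [hz.2]⟩
  have hcont : Continuous fun τ => g (a + v * τ) := by fun_prop
  have := secant_quadratic_lt_integral hcont hc hsc hs hs0
  simp only [mul_zero, add_zero, mul_neg, mul_one, ← sub_eq_add_neg] at this
  rw [intervalIntegral_comp_add_mul_scaled]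
  calc _ = v * (s * g a + s ^ 2 / 2 * (g a - g (a - v))) := by ring
    _ < _ := mul_lt_mul_of_pos_left this hv

end Convex

/-! ### The Hopf boundary lemma and the strong maximum principle. -/

section Hopf

variable {E : Type*} [NormedAddCommGroup E] [InnerProductSpace ℝ E] [FiniteDimensional ℝ E]

theorem hasDerivAt_add_smul (x v : E) (t : ℝ) : HasDerivAt (fun s : ℝ => x + s • v) v t := by
  simpa using ((hasDerivAt_id t).smul_const v).const_add x

theorem ContDiffAt.deriv_line_eventuallyEq {f : E → ℝ} {x : E} (hf : ContDiffAt ℝ 2 f x) (v : E) :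
    deriv (fun t : ℝ => f (x + t • v)) =ᶠ[𝓝 0] fun t => fderiv ℝ f (x + t • v) v := by
  have hc : Tendsto (fun t : ℝ => x + t • v) (𝓝 0) (𝓝 x) := by
    have : Continuous fun t : ℝ => x + t • v := by fun_prop
    simpa using this.tendsto 0
  filter_upwards [hc.eventually (hf.eventually (by simp))] with t ht
  exact ((ht.differentiableAt two_ne_zero).hasFDerivAt.comp_hasDerivAt t
    (hasDerivAt_add_smul x v t)).deriv

theorem ContDiffAt.deriv_deriv_line {f : E → ℝ} {x : E} (hf : ContDiffAt ℝ 2 f x) (v : E) :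
    deriv (deriv fun t : ℝ => f (x + t • v)) 0 = fderiv ℝ (fderiv ℝ f) x v v := by
  rw [(hf.deriv_line_eventuallyEq v).deriv_eq]
  have h1 : HasFDerivAt (fderiv ℝ f) (fderiv ℝ (fderiv ℝ f) x) (x + (0 : ℝ) • v) := by
    rw [zero_smul, add_zero]
    exact ((hf.fderiv_right (m := 1) (by norm_num)).differentiableAt one_ne_zero).hasFDerivAt
  have h2 := h1.comp_hasDerivAt 0 (hasDerivAt_add_smul x v 0)
  exact ((ContinuousLinearMap.apply ℝ ℝ v).hasFDerivAt.comp_hasDerivAt 0 h2).deriv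

/-- If the second derivative were negative, `0` would also be a local maximum; `h` would be locally
constant and its second derivative zero. -/
theorem deriv_deriv_nonneg_of_isLocalMin {h : ℝ → ℝ} (hc : ContinuousAt h 0)
    (hmin : IsLocalMin h 0) : 0 ≤ deriv (deriv h) 0 := by
  by_contra! hneg
  have hmax := isLocalMax_of_deriv_deriv_neg hneg hmin.deriv_eq_zero hc
  have he : h =ᶠ[𝓝 0] fun _ => h 0 := by
    filter_upwards [hmin, hmax] with t h1 h2 using le_antisymm h2 h1
  have : deriv (deriv h) 0 = 0 := by
    rw [he.deriv.deriv_eq]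
    simp
  linarith

theorem laplacian_nonneg_of_isLocalMin {f : E → ℝ} {x : E} (hf : ContDiffAt ℝ 2 f x)
    (hmin : IsLocalMin f x) : 0 ≤ (Δ f : E → ℝ) x := by
  rw [laplacian_eq_sum_fderiv_fderiv (stdOrthonormalBasis ℝ E)]
  refine Finset.sum_nonneg fun i _ => ?_
  set v := stdOrthonormalBasis ℝ E i
  rw [← hf.deriv_deriv_line v]
  have hline : ContinuousAt (fun t : ℝ => x + t • v) 0 := by fun_prop
  have hx : x + (0 : ℝ) • v = x := by simp
  refine deriv_deriv_nonneg_of_isLocalMin ?_ ?_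
  · refine ContinuousAt.comp (f := fun t : ℝ => x + t • v) (g := f) ?_ hline
    rw [hx]
    exact hf.continuousAt
  · have ht : Tendsto (fun t : ℝ => x + t • v) (𝓝 0) (𝓝 x) := by
      simpa [ContinuousAt] using hline
    filter_upwards [ht.eventually hmin] with t h
    simpa using h

/-- The barrier function of the Hopf boundary lemma. -/
noncomputable def hopfBarrier (a : ℝ) (y : E) (R : ℝ) (x : E) : ℝ :=
  Real.exp (-a * ‖x - y‖ ^ 2) - Real.exp (-a * R ^ 2)

theorem contDiff_hopfBarrier (a : ℝ) (y : E) (R : ℝ) : ContDiff ℝ 2 (hopfBarrier a y R) := by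
  unfold hopfBarrier
  exact ((contDiff_const.mul ((contDiff_id.sub contDiff_const).norm_sq ℝ)).exp).sub contDiff_const

theorem hasDerivAt_hopfBarrier_line (a : ℝ) (y : E) (R : ℝ) (x v : E) (t : ℝ) :
    HasDerivAt (fun t : ℝ => hopfBarrier a y R (x + t • v))
      (-a * (2 * inner ℝ (x - y) v + 2 * t * ‖v‖ ^ 2) *
        Real.exp (-a * ‖x + t • v - y‖ ^ 2)) t := by
  have hq : ∀ t : ℝ, ‖x + t • v - y‖ ^ 2
      = ‖x - y‖ ^ 2 + 2 * t * inner ℝ (x - y) v + t ^ 2 * ‖v‖ ^ 2 := by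
    intro t
    rw [show x + t • v - y = (x - y) + t • v by abel, norm_add_sq_real, inner_smul_right,
      norm_smul, mul_pow, Real.norm_eq_abs, sq_abs]
    ring
  have h1 : HasDerivAt (fun t : ℝ => -a * ‖x + t • v - y‖ ^ 2)
      (-a * (2 * inner ℝ (x - y) v + 2 * t * ‖v‖ ^ 2)) t := by
    simp only [hq]
    have := ((((hasDerivAt_id t).const_mul 2).mul_const (inner ℝ (x - y) v)).const_add
      (‖x - y‖ ^ 2)).add (((hasDerivAt_id t).pow 2).mul_const (‖v‖ ^ 2))
    have h := this.const_mul (-a)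
    refine (h.congr_deriv ?_).congr_of_eventuallyEq (.of_forall fun s => ?_)
    · simp
    · simp
  exact (h1.exp.sub_const (Real.exp (-a * R ^ 2))).congr_deriv (by ring)

theorem laplacian_hopfBarrier (a : ℝ) (y : E) (R : ℝ) (x : E) :
    (Δ (hopfBarrier a y R) : E → ℝ) x
      = (4 * a ^ 2 * ‖x - y‖ ^ 2 - 2 * a * Module.finrank ℝ E) *
        Real.exp (-a * ‖x - y‖ ^ 2) := by
  set b := stdOrthonormalBasis ℝ E
  have key : ∀ v : E, fderiv ℝ (fderiv ℝ (hopfBarrier a y R)) x v v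
      = (4 * a ^ 2 * (inner ℝ (x - y) v) ^ 2 - 2 * a * ‖v‖ ^ 2) *
        Real.exp (-a * ‖x - y‖ ^ 2) := by
    intro v
    rw [← (contDiff_hopfBarrier a y R).contDiffAt.deriv_deriv_line v]
    -- Writing the exponential as the barrier plus a constant lets the first-derivative formula be
    -- used again for the second derivative.
    have e : deriv (fun t : ℝ => hopfBarrier a y R (x + t • v)) = fun t : ℝ =>
        -a * (2 * inner ℝ (x - y) v + 2 * t * ‖v‖ ^ 2) *
          (hopfBarrier a y R (x + t • v) + Real.exp (-a * R ^ 2)) := by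
      funext t
      rw [(hasDerivAt_hopfBarrier_line a y R x v t).deriv, hopfBarrier, sub_add_cancel]
    rw [e]
    have h1 : HasDerivAt (fun t : ℝ => -a * (2 * inner ℝ (x - y) v + 2 * t * ‖v‖ ^ 2))
        (-a * (2 * ‖v‖ ^ 2)) 0 := by
      have := ((((hasDerivAt_id (0 : ℝ)).const_mul 2).mul_const (‖v‖ ^ 2)).const_add
        (2 * inner ℝ (x - y) v)).const_mul (-a)
      simpa using this
    have h2 := h1.mul ((hasDerivAt_hopfBarrier_line a y R x v 0).add_const (Real.exp (-a * R ^ 2)))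
    refine h2.deriv.trans ?_
    simp only [hopfBarrier, zero_smul, add_zero, sub_add_cancel, mul_zero, zero_mul]
    ring
  rw [laplacian_eq_sum_fderiv_fderiv b]
  simp only [key]
  rw [← Finset.sum_mul, Finset.sum_sub_distrib, ← Finset.mul_sum, ← Finset.mul_sum]
  have e1 : ∑ i, (inner ℝ (x - y) (b i) : ℝ) ^ 2 = ‖x - y‖ ^ 2 := by
    have := b.sum_sq_norm_inner_left (x - y)
    simpa [real_inner_comm] using this
  have e2 : ∑ i, ‖b i‖ ^ 2 = (Module.finrank ℝ E : ℝ) := by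
    simp
  rw [e1, e2]

/-- The Hopf boundary lemma on a ball, at a boundary zero `z` of a function that is positive in the
ball. -/
theorem hopf_boundary {U : Set E} (hU : IsOpen U) {w : E → ℝ} (hw : ContDiffOn ℝ 2 w U) {y z : E}
    {R : ℝ} (hR : 0 < R) (hball : Metric.closedBall y R ⊆ U)
    (hpos : ∀ x ∈ Metric.ball y R, 0 < w x) {L : ℝ} (hL : 0 ≤ L)
    (hΔ : ∀ x ∈ Metric.ball y R, (Δ w : E → ℝ) x ≤ L * w x) (hz : dist z y = R) (hz0 : w z = 0) :
    0 < fderiv ℝ w z (y - z) := by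
  have hwc : ContinuousOn w (Metric.closedBall y R) := hw.continuousOn.mono hball
  have hnonneg : ∀ x ∈ Metric.closedBall y R, 0 ≤ w x := by
    intro x hx
    rw [← closure_ball y hR.ne'] at hx hwc
    have hc : IsClosed (closure (Metric.ball y R) ∩ w ⁻¹' Ici 0) :=
      hwc.preimage_isClosed_of_isClosed isClosed_closure isClosed_Ici
    have hsub : Metric.ball y R ⊆ closure (Metric.ball y R) ∩ w ⁻¹' Ici 0 := fun p hp =>
      ⟨subset_closure hp, mem_preimage.2 (hpos p hp).le⟩
    exact (closure_minimal hsub hc hx).2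
  set n : ℝ := (Module.finrank ℝ E : ℝ)
  have hn : 0 ≤ n := Nat.cast_nonneg _
  -- Where `‖x - y‖ ≥ R/2` the barrier has Laplacian at least `(a²R² - 2an)` times its exponential,
  -- and is itself at most that exponential. The inequality therefore gives `Δh > L h` on the
  -- annulus.
  obtain ⟨a, ha, haL⟩ : ∃ a : ℝ, 0 < a ∧ 2 * a * n + L < a ^ 2 * R ^ 2 := by
    refine ⟨(2 * n + L + 1) / R ^ 2 + 1, by positivity, ?_⟩
    set q := (2 * n + L + 1) / R ^ 2
    have hq : q * R ^ 2 = 2 * n + L + 1 := div_mul_cancel₀ _ (by positivity)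
    have hq0 : 0 ≤ q := by positivity
    have hR2 : 0 < R ^ 2 := by positivity
    have e : (q + 1) ^ 2 * R ^ 2 = (q + 1) * (2 * n + L + 1) + (q + 1) * R ^ 2 := by
      rw [← hq]; ring
    rw [e]
    nlinarith [mul_nonneg hq0 hL, mul_pos (by linarith : 0 < q + 1) hR2]
  set h := hopfBarrier a y R
  have hh : ContDiff ℝ 2 h := contDiff_hopfBarrier a y R
  -- the inner sphere
  have hin : ∃ m, 0 < m ∧ ∀ x, dist x y = R / 2 → m ≤ w x := by
    have hsub : Metric.sphere y (R / 2) ⊆ Metric.ball y R := fun x hx => by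
      rw [Metric.mem_sphere] at hx
      rw [Metric.mem_ball]
      linarith
    rcases (Metric.sphere y (R / 2)).eq_empty_or_nonempty with he | hne
    · exact ⟨1, one_pos, fun x hx => absurd (show x ∈ Metric.sphere y (R / 2) from hx) (by simp [he])⟩
    · obtain ⟨p, hp, hpm⟩ := (isCompact_sphere y (R / 2)).exists_isMinOn hne
        (hwc.mono (hsub.trans Metric.ball_subset_closedBall))
      exact ⟨w p, hpos p (hsub hp), fun x hx => hpm hx⟩
  obtain ⟨m, hm, hmw⟩ := hin
  have hhle : ∀ x, h x ≤ Real.exp (-a * ‖x - y‖ ^ 2) := fun x => by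
    simp only [h, hopfBarrier]
    linarith [Real.exp_pos (-a * R ^ 2)]
  have hh1 : ∀ x, h x ≤ 1 := fun x => (hhle x).trans (Real.exp_le_one_iff.2 (by
    have := mul_nonneg ha.le (sq_nonneg ‖x - y‖)
    linarith))
  have hhR : ∀ x, dist x y = R → h x = 0 := fun x hx => by
    simp only [h, hopfBarrier]
    rw [← dist_eq_norm, hx, sub_self]
  set A := Metric.closedBall y R ∩ {x | R / 2 ≤ dist x y}
  have hA : IsCompact A := (isCompact_closedBall y R).inter_right
    (isClosed_le continuous_const (by fun_prop))
  -- At a negative minimum of `w - m h` over the annulus the Laplacian would be nonnegative, whereas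
  -- `Δw ≤ L w < L m h < m Δh` up to replacing `h` by its exponential. The minimum is interior: on
  -- the outer sphere `h = 0 ≤ w`, on the inner one `m h ≤ m ≤ w`.
  have hcomp : ∀ x ∈ A, m * h x ≤ w x := by
    by_contra! hcon
    obtain ⟨x₁, hx₁, hlt⟩ := hcon
    have hgc : ContinuousOn (fun x => w x - m * h x) A :=
      (hwc.mono inter_subset_left).sub (continuousOn_const.mul hh.continuous.continuousOn)
    obtain ⟨x₀, hx₀, hmin⟩ := hA.exists_isMinOn ⟨x₁, hx₁⟩ hgc
    have hneg : w x₀ - m * h x₀ < 0 := lt_of_le_of_lt (hmin hx₁) (by linarith)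
    have hne1 : dist x₀ y ≠ R := fun he => by
      rw [hhR x₀ he] at hneg
      linarith [hnonneg x₀ hx₀.1]
    have hne2 : dist x₀ y ≠ R / 2 := fun he => by
      have := hmw x₀ he
      nlinarith [hh1 x₀]
    have hlt1 : dist x₀ y < R := lt_of_le_of_ne hx₀.1 hne1
    have hlt2 : R / 2 < dist x₀ y := lt_of_le_of_ne hx₀.2 (Ne.symm hne2)
    have hnhds : A ∈ 𝓝 x₀ := by
      have ho : IsOpen (Metric.ball y R ∩ {x | R / 2 < dist x y}) :=
        Metric.isOpen_ball.inter (isOpen_lt continuous_const (by fun_prop))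
      exact mem_of_superset (ho.mem_nhds ⟨hlt1, hlt2⟩) fun x hx =>
        ⟨Metric.ball_subset_closedBall hx.1, (show R / 2 < dist x y from hx.2).le⟩
    have hwx : ContDiffAt ℝ 2 w x₀ := hw.contDiffAt (hU.mem_nhds (hball hx₀.1))
    have hmh : ContDiffAt ℝ 2 (m • h) x₀ := hh.contDiffAt.const_smul m
    have hloc : IsLocalMin (w - m • h) x₀ := by
      filter_upwards [hnhds] with x hx
      exact hmin hx
    have hge : 0 ≤ (Δ (w - m • h) : E → ℝ) x₀ :=
      laplacian_nonneg_of_isLocalMin (hwx.sub hmh) hloc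
    rw [hwx.laplacian_sub hmh, InnerProductSpace.laplacian_smul m hh.contDiffAt, smul_eq_mul,
      laplacian_hopfBarrier, ← dist_eq_norm] at hge
    have h1 := hΔ x₀ hlt1
    set ex := Real.exp (-a * dist x₀ y ^ 2)
    have hex : 0 < ex := Real.exp_pos _
    have h2 : h x₀ ≤ ex := by
      have := hhle x₀
      rwa [← dist_eq_norm] at this
    have h3 : L * ex < (4 * a ^ 2 * dist x₀ y ^ 2 - 2 * a * n) * ex := by
      refine mul_lt_mul_of_pos_right ?_ hex
      have : R ^ 2 ≤ 4 * dist x₀ y ^ 2 := by nlinarith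
      nlinarith [mul_le_mul_of_nonneg_left this (sq_nonneg a)]
    have h4 : L * h x₀ ≤ L * ex := mul_le_mul_of_nonneg_left h2 hL
    have h5 : m * (L * h x₀) < m * ((4 * a ^ 2 * dist x₀ y ^ 2 - 2 * a * n) * ex) :=
      mul_lt_mul_of_pos_left (h4.trans_lt h3) hm
    have h6 : L * (w x₀ - m * h x₀) ≤ 0 := mul_nonpos_of_nonneg_of_nonpos hL hneg.le
    nlinarith
  -- compare the derivatives at `z` in the inner normal direction
  have hzU : z ∈ U := hball (by rw [Metric.mem_closedBall, hz])
  have hd1 : HasDerivAt (fun t : ℝ => w (z + t • (y - z))) (fderiv ℝ w z (y - z)) 0 := by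
    have hwz : HasFDerivAt w (fderiv ℝ w z) (z + (0 : ℝ) • (y - z)) := by
      rw [zero_smul, add_zero]
      exact ((hw.contDiffAt (hU.mem_nhds hzU)).differentiableAt two_ne_zero).hasFDerivAt
    exact hwz.comp_hasDerivAt 0 (hasDerivAt_add_smul z (y - z) 0)
  have hd2 := hasDerivAt_hopfBarrier_line a y R z (y - z) 0
  have hzy : inner ℝ (z - y) (y - z) = -R ^ 2 := by
    rw [← neg_sub z y, inner_neg_right, real_inner_self_eq_norm_sq, ← dist_eq_norm, hz]
  rw [hzy, mul_zero, zero_mul, add_zero, zero_smul, add_zero, ← dist_eq_norm, hz] at hd2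
  have hd := hd1.sub (hd2.const_mul m)
  have hge : 0 ≤ fderiv ℝ w z (y - z) -
      m * (-a * (2 * -R ^ 2) * Real.exp (-a * R ^ 2)) := by
    refine ge_of_tendsto hd.tendsto_slope_zero_right ?_
    filter_upwards [Ioc_mem_nhdsGT (show (0 : ℝ) < 1 / 2 by norm_num)] with t ht
    have hmem : z + t • (y - z) ∈ A := by
      have hdist : dist (z + t • (y - z)) y = (1 - t) * R := by
        rw [dist_eq_norm, show z + t • (y - z) - y = (1 - t) • (z - y) by module, norm_smul,
          ← dist_eq_norm z y, hz, Real.norm_of_nonneg (by linarith [ht.2])]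
      constructor
      · rw [Metric.mem_closedBall, hdist]
        nlinarith [ht.1]
      · rw [Set.mem_ofPred_eq, hdist]
        nlinarith [ht.2]
    have := hcomp _ hmem
    have hz1 : h z = 0 := hhR z hz
    simp only [Pi.sub_apply, zero_add, zero_smul, add_zero, hz0, smul_eq_mul]
    refine mul_nonneg (inv_nonneg.2 ht.1.le) ?_
    change 0 ≤ w (z + t • (y - z)) - m * h (z + t • (y - z)) - (0 - m * h z)
    rw [hz1]
    linarith
  have : 0 < m * (a * (2 * R ^ 2) * Real.exp (-a * R ^ 2)) := by
    have := Real.exp_pos (-a * R ^ 2)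
    positivity
  linarith

/-- The strong maximum principle for nonnegative solutions of `Δw ≤ L w`. -/
theorem eq_zero_of_laplacian_le {U : Set E} (hU : IsOpen U) (hUc : IsPreconnected U) {w : E → ℝ}
    (hw : ContDiffOn ℝ 2 w U) (hnonneg : ∀ x ∈ U, 0 ≤ w x) {L : ℝ} (hL : 0 ≤ L)
    (hΔ : ∀ x ∈ U, (Δ w : E → ℝ) x ≤ L * w x) (hzero : ∃ z ∈ U, w z = 0) :
    ∀ x ∈ U, w x = 0 := by
  have hwc := hw.continuousOn
  set Z := U ∩ {x | w x = 0}
  have hZ : IsOpen Z := by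
    rw [Metric.isOpen_iff]
    rintro z ⟨hzU, hz0⟩
    obtain ⟨ρ, hρ, hball⟩ := Metric.isOpen_iff.1 hU z hzU
    refine ⟨ρ / 2, half_pos hρ, fun y hy => ?_⟩
    rw [Metric.mem_ball] at hy
    have hyU : y ∈ U := hball (by rw [Metric.mem_ball]; linarith)
    refine ⟨hyU, ?_⟩
    by_contra hne
    have hwy : 0 < w y := lt_of_le_of_ne (hnonneg y hyU) (Ne.symm hne)
    have hcb : ∀ r ≤ dist y z, Metric.closedBall y r ⊆ U := fun r hr p hp => by
      refine hball ?_
      rw [Metric.mem_closedBall] at hp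
      rw [Metric.mem_ball]
      linarith [dist_triangle p y z]
    have hcl : IsCompact (Metric.closedBall y (dist y z) ∩ w ⁻¹' {0}) :=
      (isCompact_closedBall _ _).of_isClosed_subset
        ((hwc.mono (hcb _ le_rfl)).preimage_isClosed_of_isClosed Metric.isClosed_closedBall
          isClosed_singleton) inter_subset_left
    -- The zero `p` is one nearest to `y`, so the open ball about `y` through `p` contains no zeros.
    -- The Hopf lemma then gives a nonzero derivative at `p`, an interior minimum of `w`.
    obtain ⟨p, ⟨hp1, hp2⟩, hpmin⟩ := hcl.exists_isMinOn (f := fun x => dist x y)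
      ⟨z, by simp [dist_comm], hz0⟩ (by fun_prop)
    have hp2' : w p = 0 := hp2
    have hpU : p ∈ U := hcb _ le_rfl hp1
    have hr : 0 < dist p y := dist_pos.2 fun h => hwy.ne' (h ▸ hp2')
    have hple : dist p y ≤ dist y z := hp1
    have hb := hcb _ hple
    have hder := hopf_boundary hU hw hr hb (fun x hx => ?_) hL
      (fun x hx => hΔ x (hb (Metric.ball_subset_closedBall hx))) rfl hp2'
    · have hmin : IsLocalMin w p := by
        filter_upwards [hU.mem_nhds hpU] with x hx
        rw [hp2']
        exact hnonneg x hx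
      rw [hmin.fderiv_eq_zero] at hder
      simp at hder
    · refine lt_of_le_of_ne (hnonneg x (hb (Metric.ball_subset_closedBall hx))) fun h0 => ?_
      rw [Metric.mem_ball] at hx
      have := hpmin (show x ∈ _ from ⟨Metric.mem_closedBall.2 (hx.le.trans hple), h0.symm⟩)
      exact absurd this (not_le.2 hx)
  obtain ⟨z, hzU, hz0⟩ := hzero
  have := hUc.subset_of_closure_inter_subset hZ ⟨z, hzU, hzU, hz0⟩ fun x hx => by
    refine ⟨hx.2, ?_⟩
    obtain ⟨s, hs, hlim⟩ := mem_closure_iff_seq_limit.1 hx.1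
    have h1 := (hwc.continuousAt (hU.mem_nhds hx.2)).tendsto.comp hlim
    exact tendsto_nhds_unique h1 (tendsto_const_nhds.congr fun n => ((hs n).2).symm)
  exact fun x hx => (this hx).2

end Hopf

/-! ### Reflection and odd functions. -/

section Isometry

variable {E : Type*} [NormedAddCommGroup E] [InnerProductSpace ℝ E] [FiniteDimensional ℝ E]

theorem laplacian_comp_linearIsometryEquiv (e : E ≃ₗᵢ[ℝ] E) {u : E → ℝ} {x : E}
    (hu : ContDiffAt ℝ 2 u (e x)) :
    (Δ (fun y => u (e y)) : E → ℝ) x = (Δ u : E → ℝ) (e x) := by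
  have hue : ContDiffAt ℝ 2 (fun y => u (e y)) x := hu.comp x e.contDiff.contDiffAt
  set b := stdOrthonormalBasis ℝ E
  rw [laplacian_eq_sum_fderiv_fderiv b, laplacian_eq_sum_fderiv_fderiv (b.map e)]
  refine Finset.sum_congr rfl fun i _ => ?_
  rw [← hue.deriv_deriv_line, ← hu.deriv_deriv_line]
  simp

end Isometry

namespace PartialSymmetry

variable {N : ℕ} [NeZero N]

local notation "E" => EuclideanSpace ℝ (Fin N)

@[simp] theorem reflect_zero (x : E) : reflect x 0 = -x 0 := by
  simp [reflect]

theorem reflect_of_ne (x : E) {i : Fin N} (hi : i ≠ 0) : reflect x i = x i := by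
  simp [reflect, hi]

/-- The reflection on `{x₁ = 0}` as a linear isometry. -/
noncomputable def reflectIso (N : ℕ) [NeZero N] :
    EuclideanSpace ℝ (Fin N) ≃ₗᵢ[ℝ] EuclideanSpace ℝ (Fin N) :=
  LinearIsometryEquiv.piLpCongrRight 2 fun i : Fin N =>
    if i = 0 then LinearIsometryEquiv.neg ℝ else LinearIsometryEquiv.refl ℝ ℝ

theorem reflectIso_apply (x : E) : reflectIso N x = reflect x := by
  ext i
  by_cases hi : i = 0
  · subst hi
    simp [reflectIso]
  · simp [reflectIso, hi, reflect_of_ne]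

@[simp] theorem reflect_reflect (x : E) : reflect (reflect x) = x := by
  ext i
  by_cases hi : i = 0
  · subst hi
    simp
  · simp [hi, reflect_of_ne]

theorem reflect_eq_self {x : E} (hx : x 0 = 0) : reflect x = x := by
  ext i
  by_cases hi : i = 0
  · subst hi
    simp [hx]
  · simp [hi, reflect_of_ne]

theorem dist_reflect_reflect (x y : E) : dist (reflect x) (reflect y) = dist x y := by
  rw [← reflectIso_apply, ← reflectIso_apply, LinearIsometryEquiv.dist_map]

theorem contDiff_reflect : ContDiff ℝ 2 (reflect : E → E) := by
  have : (reflect : E → E) = reflectIso N := funext fun x => (reflectIso_apply x).symm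
  rw [this]
  exact (reflectIso N).contDiff

theorem laplacian_comp_reflect {u : E → ℝ} {x : E} (hu : ContDiffAt ℝ 2 u (reflect x)) :
    (Δ (fun y => u (reflect y)) : E → ℝ) x = (Δ u : E → ℝ) (reflect x) := by
  simp only [← reflectIso_apply] at hu ⊢
  exact laplacian_comp_linearIsometryEquiv (reflectIso N) hu

variable {Ω : Set (EuclideanSpace ℝ (Fin N))}

theorem isOpen_coord_pos : IsOpen {x : E | 0 < x 0} :=
  isOpen_lt continuous_const (by fun_prop)

/-- An odd function with `Δw ≤ L w` and `w ≥ 0` in `Ω₊` that has a critical zero on `T ∩ Ω`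
vanishes. -/
theorem eq_zero_of_odd_of_laplacian_le (hΩ : IsOpen Ω) (hΩc : IsPreconnected Ω)
    (hΩs : ∀ x ∈ Ω, reflect x ∈ Ω) {w : E → ℝ} (hw : ContDiffOn ℝ 2 w Ω)
    (hodd : ∀ x ∈ Ω, w (reflect x) = -w x) {L : ℝ} (hL : 0 ≤ L)
    (hΔ : ∀ x ∈ halfPos Ω, (Δ w : E → ℝ) x ≤ L * w x) (hnonneg : ∀ x ∈ halfPos Ω, 0 ≤ w x)
    {P : E} (hP : P ∈ Ω) (hP0 : P 0 = 0) (hPd : fderiv ℝ w P = 0) : ∀ x ∈ Ω, w x = 0 := by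
  have hself : ∀ x ∈ Ω, x 0 = 0 → w x = 0 := fun x hx h0 => by
    have := hodd x hx
    rw [reflect_eq_self h0] at this
    linarith
  have hwc := hw.continuousOn
  have hdc : ContinuousOn (fderiv ℝ w) Ω := hw.continuousOn_fderiv_of_isOpen hΩ (by norm_num)
  have hopen : IsOpen (halfPos Ω) := hΩ.inter isOpen_coord_pos
  -- local vanishing in the positive half
  have hlocpos : ∀ z ∈ halfPos Ω, w z = 0 → ∃ ρ > 0, Metric.ball z ρ ⊆ Ω ∧
      ∀ x ∈ Metric.ball z ρ, w x = 0 := by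
    intro z hz hz0
    obtain ⟨ρ, hρ, hb⟩ := Metric.isOpen_iff.1 hopen z hz
    exact ⟨ρ, hρ, fun x hx => (hb hx).1, eq_zero_of_laplacian_le Metric.isOpen_ball
      (convex_ball z ρ).isPreconnected (hw.mono fun x hx => (hb hx).1)
      (fun x hx => hnonneg x (hb hx)) hL (fun x hx => hΔ x (hb hx))
      ⟨z, Metric.mem_ball_self hρ, hz0⟩⟩
  have hloc : ∀ z ∈ Ω, w z = 0 → fderiv ℝ w z = 0 → ∃ ρ > 0, Metric.ball z ρ ⊆ Ω ∧
      ∀ x ∈ Metric.ball z ρ, w x = 0 := by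
    intro z hz hz0 hzd
    rcases lt_trichotomy (z 0) 0 with h | h | h
    · obtain ⟨ρ, hρ, hb, hb0⟩ := hlocpos (reflect z) ⟨hΩs z hz, by simpa using h⟩
        (by rw [hodd z hz, hz0, neg_zero])
      have hmem : ∀ x ∈ Metric.ball z ρ, reflect x ∈ Metric.ball (reflect z) ρ := fun x hx => by
        rwa [Metric.mem_ball, dist_reflect_reflect]
      have hΩx : ∀ x ∈ Metric.ball z ρ, x ∈ Ω := fun x hx => by
        simpa using hΩs _ (hb (hmem x hx))
      refine ⟨ρ, hρ, hΩx, fun x hx => ?_⟩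
      have h1 := hb0 _ (hmem x hx)
      rw [hodd x (hΩx x hx)] at h1
      linarith
    · obtain ⟨ρ, hρ, hb⟩ := Metric.isOpen_iff.1 hΩ z hz
      set H := Metric.ball z ρ ∩ {x : E | 0 < x 0}
      have hHo : IsOpen H := Metric.isOpen_ball.inter isOpen_coord_pos
      have hHc : Convex ℝ H := by
        refine (convex_ball z ρ).inter fun x hx y hy a b ha hb hab => ?_
        have hx' : 0 < x 0 := hx
        have hy' : 0 < y 0 := hy
        change 0 < (a • x + b • y) 0
        simp only [PiLp.add_apply, PiLp.smul_apply, smul_eq_mul]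
        rcases ha.eq_or_lt with rfl | ha
        · have : b = 1 := by linarith
          simpa [this] using hy'
        · have := mul_pos ha hx'
          have := mul_nonneg hb hy'.le
          linarith
      have hHΩ : H ⊆ halfPos Ω := fun x hx => ⟨hb hx.1, hx.2⟩
      -- If `w` had no zero in the half ball, the Hopf lemma on a ball tangent to `T` at `z` would
      -- contradict the vanishing gradient. The radius `ρ/3` keeps the closed tangent ball within
      -- distance `2ρ/3` of `z`.
      have hzero : ∃ p ∈ H, w p = 0 := by
        by_contra! hne
        have hHpos : ∀ p ∈ H, 0 < w p := fun p hp =>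
          lt_of_le_of_ne (hnonneg p (hHΩ hp)) (hne p hp).symm
        set e : E := EuclideanSpace.single 0 1
        have hen : ‖e‖ = 1 := by simp [e]
        set y : E := z + (ρ / 3) • e
        have hR : 0 < ρ / 3 := by positivity
        have hzy : dist z y = ρ / 3 := by
          rw [dist_eq_norm, show z - y = -((ρ / 3) • e) by simp [y], norm_neg, norm_smul, hen,
            mul_one, Real.norm_of_nonneg hR.le]
        have hy0 : y 0 = ρ / 3 := by simp [y, e, h]
        have hball : Metric.closedBall y (ρ / 3) ⊆ Metric.ball z ρ := fun x hx => by
          rw [Metric.mem_closedBall] at hx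
          rw [Metric.mem_ball]
          have := dist_triangle x y z
          rw [dist_comm y z, hzy] at this
          linarith
        have hbH : Metric.ball y (ρ / 3) ⊆ H := fun x hx => by
          refine ⟨hball (Metric.ball_subset_closedBall hx), ?_⟩
          rw [Metric.mem_ball, dist_eq_norm] at hx
          have h1 := (PiLp.norm_apply_le (x - y) 0).trans_lt hx
          rw [PiLp.sub_apply, hy0, Real.norm_eq_abs, abs_lt] at h1
          change 0 < x 0
          linarith [h1.1]
        have := hopf_boundary hΩ hw hR (hball.trans hb) (fun x hx => hHpos x (hbH hx)) hL
          (fun x hx => hΔ x (hHΩ (hbH hx))) hzy hz0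
        rw [hzd] at this
        simp at this
      have hH0 := eq_zero_of_laplacian_le hHo hHc.isPreconnected (hw.mono fun x hx => (hHΩ hx).1)
        (fun x hx => hnonneg x (hHΩ hx)) hL (fun x hx => hΔ x (hHΩ hx)) hzero
      refine ⟨ρ, hρ, hb, fun x hx => ?_⟩
      rcases lt_trichotomy (x 0) 0 with hx0 | hx0 | hx0
      · have hmem : reflect x ∈ H := by
          refine ⟨?_, ?_⟩
          · rw [Metric.mem_ball, ← reflect_eq_self h, dist_reflect_reflect]
            exact hx
          · change 0 < reflect x 0
            simpa using hx0
        have h1 := hH0 _ hmem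
        rw [hodd x (hb hx)] at h1
        linarith
      · exact hself x (hb hx) hx0
      · exact hH0 x ⟨hx, hx0⟩
    · exact hlocpos z ⟨hz, h⟩ hz0
  -- An odd function vanishes on all of `T`, so the zero set alone need not be open. Adding the
  -- vanishing of the derivative makes the set open, and it stays relatively closed.
  set Z := {x | x ∈ Ω ∧ w x = 0 ∧ fderiv ℝ w x = 0}
  have hZ : IsOpen Z := by
    rw [Metric.isOpen_iff]
    rintro z ⟨hz, hz0, hzd⟩
    obtain ⟨ρ, hρ, hb, hb0⟩ := hloc z hz hz0 hzd
    refine ⟨ρ, hρ, fun x hx => ⟨hb hx, hb0 x hx, ?_⟩⟩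
    have he : w =ᶠ[𝓝 x] fun _ => 0 := by
      filter_upwards [Metric.isOpen_ball.mem_nhds hx] with y hy using hb0 y hy
    rw [he.fderiv_eq]
    simp
  have hsub := hΩc.subset_of_closure_inter_subset hZ ⟨P, hP, hP, hself P hP hP0, hPd⟩
    fun x hx => by
      obtain ⟨q, hq, hlim⟩ := mem_closure_iff_seq_limit.1 hx.1
      have h1 := (hwc.continuousAt (hΩ.mem_nhds hx.2)).tendsto.comp hlim
      have h2 := (hdc.continuousAt (hΩ.mem_nhds hx.2)).tendsto.comp hlim
      exact ⟨hx.2, tendsto_nhds_unique h1 (tendsto_const_nhds.congr fun n => (hq n).2.1.symm),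
        tendsto_nhds_unique h2 (tendsto_const_nhds.congr fun n => (hq n).2.2.symm)⟩
  exact fun x hx => (hsub hx).2.1

theorem isOpen_halfPos (hΩ : IsOpen Ω) : IsOpen (halfPos Ω) := hΩ.inter isOpen_coord_pos

theorem isOpen_halfNeg (hΩ : IsOpen Ω) : IsOpen (halfNeg Ω) :=
  hΩ.inter (show IsOpen {x : E | x 0 < 0} from isOpen_lt (by fun_prop) continuous_const)

theorem frontier_halfPos_subset (hΩ : IsOpen Ω) :
    frontier (halfPos Ω) ⊆ frontier Ω ∪ {x | x 0 = 0} := by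
  intro x hx
  rw [(isOpen_halfPos hΩ).frontier_eq] at hx
  by_cases hxΩ : x ∈ Ω
  · have hge : halfPos Ω ⊆ {x : E | 0 ≤ x 0} := fun y hy => le_of_lt (show 0 < y 0 from hy.2)
    have hc : IsClosed {x : E | 0 ≤ x 0} := isClosed_le continuous_const (by fun_prop)
    have h1 : 0 ≤ x 0 := closure_minimal hge hc hx.1
    exact .inr (le_antisymm (not_lt.1 fun h => hx.2 ⟨hxΩ, h⟩) h1)
  · left
    rw [hΩ.frontier_eq]
    exact ⟨closure_mono (fun y hy => hy.1) hx.1, hxΩ⟩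

theorem frontier_halfNeg_subset (hΩ : IsOpen Ω) :
    frontier (halfNeg Ω) ⊆ frontier Ω ∪ {x | x 0 = 0} := by
  intro x hx
  rw [(isOpen_halfNeg hΩ).frontier_eq] at hx
  by_cases hxΩ : x ∈ Ω
  · have hge : halfNeg Ω ⊆ {x : E | x 0 ≤ 0} := fun y hy => le_of_lt (show y 0 < 0 from hy.2)
    have hc : IsClosed {x : E | x 0 ≤ 0} := isClosed_le (by fun_prop) continuous_const
    have h1 : x 0 ≤ 0 := closure_minimal hge hc hx.1
    exact .inr (le_antisymm h1 (not_lt.1 fun h => hx.2 ⟨hxΩ, h⟩))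
  · left
    rw [hΩ.frontier_eq]
    exact ⟨closure_mono (fun y hy => hy.1) hx.1, hxΩ⟩

theorem preimage_reflect_eq (hΩs : ∀ x ∈ Ω, reflect x ∈ Ω) : reflectIso N ⁻¹' Ω = Ω := by
  ext x
  simp only [mem_preimage, reflectIso_apply]
  exact ⟨fun h => by simpa using hΩs _ h, hΩs x⟩

theorem reflect_mem_closure (hΩs : ∀ x ∈ Ω, reflect x ∈ Ω) {x : E} (hx : x ∈ closure Ω) :
    reflect x ∈ closure Ω := by
  have h := (reflectIso N).toHomeomorph.preimage_closure Ω
  simp only [LinearIsometryEquiv.coe_toHomeomorph] at h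
  rw [preimage_reflect_eq hΩs] at h
  rw [← h] at hx
  simpa [reflectIso_apply] using hx

theorem reflect_mem_frontier (hΩs : ∀ x ∈ Ω, reflect x ∈ Ω) {x : E} (hx : x ∈ frontier Ω) :
    reflect x ∈ frontier Ω := by
  have h := (reflectIso N).toHomeomorph.preimage_frontier Ω
  simp only [LinearIsometryEquiv.coe_toHomeomorph] at h
  rw [preimage_reflect_eq hΩs] at h
  rw [← h] at hx
  simpa [reflectIso_apply] using hx

end PartialSymmetry

/-! ### The integrated secant inequality. -/

section Superposition

variable {α : Type*} [MeasurableSpace α] {μ : Measure α} [IsFiniteMeasure μ] {f : α → ℝ → ℝ}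
  {u v : α → ℝ} {T B : ℝ}

theorem integrable_superposition (hm : ∀ t, AEMeasurable (fun x => f x t) μ)
    (hc : ∀ᵐ x ∂μ, Continuous (f x)) (hB : ∀ᵐ x ∂μ, ∀ t, |t| ≤ T → |f x t| ≤ B)
    (hu : AEMeasurable u μ) (huT : ∀ᵐ x ∂μ, |u x| ≤ T) : Integrable (fun x => f x (u x)) μ := by
  refine Integrable.of_bound (aemeasurable_superposition hm hc hu).aestronglyMeasurable B ?_
  filter_upwards [hB, huT] with x h1 h2 using h1 _ h2

theorem integrable_intervalIntegral_superposition (hm : ∀ t, AEMeasurable (fun x => f x t) μ)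
    (hc : ∀ᵐ x ∂μ, Continuous (f x)) (hB : ∀ᵐ x ∂μ, ∀ t, |t| ≤ T → |f x t| ≤ B)
    (hu : AEMeasurable u μ) (huT : ∀ᵐ x ∂μ, |u x| ≤ T) :
    Integrable (fun x => ∫ s in (0 : ℝ)..(u x), f x s) μ := by
  refine Integrable.of_bound
    (aemeasurable_intervalIntegral_superposition hm hc hu).aestronglyMeasurable (B * T) ?_
  filter_upwards [hB, huT] with x h1 h2
  have hB0 : 0 ≤ B := (abs_nonneg _).trans (h1 _ h2)
  have h3 := intervalIntegral.norm_integral_le_of_norm_le_const (a := 0) (b := u x) (f := f x)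
    (C := B) fun t ht => h1 t (by
      have := uIoc_subset_uIcc ht
      rw [mem_uIcc] at this
      refine le_trans ?_ h2
      rcases this with h | h
      · rw [abs_of_nonneg h.1]
        exact h.2.trans (le_abs_self _)
      · rw [abs_of_nonpos h.2, abs_of_nonpos (h.1.trans h.2)]
        linarith [h.1])
  rw [sub_zero] at h3
  exact h3.trans (mul_le_mul_of_nonneg_left h2 hB0)

theorem abs_add_mul_le {a b s T : ℝ} (h : |a| + |b| ≤ T) (hs : s ∈ Icc (-1 : ℝ) 1) :
    |a + s * b| ≤ T := by
  refine (abs_add_le _ _).trans (le_trans ?_ h)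
  rw [abs_mul]
  have := mul_le_of_le_one_left (abs_nonneg b) (abs_le.2 hs)
  linarith

theorem integrable_intervalIntegral_shift (hm : ∀ t, AEMeasurable (fun x => f x t) μ)
    (hc : ∀ᵐ x ∂μ, Continuous (f x)) (hB : ∀ᵐ x ∂μ, ∀ t, |t| ≤ T → |f x t| ≤ B)
    (hu : AEMeasurable u μ) (hv : AEMeasurable v μ) (hT : ∀ᵐ x ∂μ, |u x| + |v x| ≤ T) {s : ℝ}
    (hs : s ∈ Icc (-1 : ℝ) 1) :
    Integrable (fun x => ∫ τ in (u x)..(u x + s * v x), f x τ) μ := by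
  have h1 := integrable_intervalIntegral_superposition hm hc hB (hu.add (hv.const_mul s))
    (hT.mono fun x hx => abs_add_mul_le hx hs)
  have h2 := integrable_intervalIntegral_superposition hm hc hB hu
    (hT.mono fun x hx => by linarith [abs_nonneg (v x)])
  refine (h1.sub h2).congr ?_
  filter_upwards [hc] with x hx
  exact intervalIntegral.integral_interval_sub_left (hx.intervalIntegrable _ _)
    (hx.intervalIntegrable _ _)

/-- The integrated secant inequality for a superposition operator that is convex between
`u - v` and `u + v`. -/
theorem integral_secant_le (hm : ∀ t, AEMeasurable (fun x => f x t) μ)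
    (hc : ∀ᵐ x ∂μ, Continuous (f x)) (hB : ∀ᵐ x ∂μ, ∀ t, |t| ≤ T → |f x t| ≤ B)
    (hu : AEMeasurable u μ) (hv : AEMeasurable v μ) (hT : ∀ᵐ x ∂μ, |u x| + |v x| ≤ T)
    (hconv : ∀ᵐ x ∂μ, v x ≠ 0 → 0 < v x ∧ ConvexOn ℝ (Icc (u x - v x) (u x + v x)) (f x)) {s : ℝ}
    (hs : s ∈ Icc (-1 : ℝ) 1) :
    s * (∫ x, f x (u x) * v x ∂μ) + s ^ 2 / 2 * (∫ x, (f x (u x) - f x (u x - v x)) * v x ∂μ)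
        ≤ (∫ x, (∫ τ in (u x)..(u x + s * v x), f x τ) ∂μ) ∧
      ((∀ᵐ x ∂μ, v x ≠ 0 → StrictConvexOn ℝ (Icc (u x - v x) (u x)) (f x)) → s ≠ 0 →
        ¬ v =ᵐ[μ] 0 →
        s * (∫ x, f x (u x) * v x ∂μ) + s ^ 2 / 2 * (∫ x, (f x (u x) - f x (u x - v x)) * v x ∂μ)
          < ∫ x, (∫ τ in (u x)..(u x + s * v x), f x τ) ∂μ) := by
  have hJ := integrable_intervalIntegral_shift hm hc hB hu hv hT hs
  have huT : ∀ᵐ x ∂μ, |u x| ≤ T := hT.mono fun x hx => by linarith [abs_nonneg (v x)]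
  have hvT : ∀ᵐ x ∂μ, ‖v x‖ ≤ T := hT.mono fun x hx => by
    rw [Real.norm_eq_abs]
    linarith [abs_nonneg (u x)]
  have huvT : ∀ᵐ x ∂μ, |u x - v x| ≤ T := hT.mono fun x hx => (abs_sub _ _).trans hx
  have I1 := integrable_superposition hm hc hB hu huT
  have I2 := integrable_superposition hm hc hB (hu.sub hv) huvT
  have I3 : Integrable (fun x => f x (u x) * v x) μ := I1.mul_bdd hv.aestronglyMeasurable hvT
  have I4 : Integrable (fun x => (f x (u x) - f x (u x - v x)) * v x) μ :=
    (I1.sub I2).mul_bdd hv.aestronglyMeasurable hvT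
  have I5 : Integrable (fun x => s * (f x (u x) * v x) +
      s ^ 2 / 2 * ((f x (u x) - f x (u x - v x)) * v x)) μ :=
    (I3.const_mul s).add (I4.const_mul (s ^ 2 / 2))
  have e : s * (∫ x, f x (u x) * v x ∂μ)
        + s ^ 2 / 2 * (∫ x, (f x (u x) - f x (u x - v x)) * v x ∂μ)
      = ∫ x, (s * (f x (u x) * v x) + s ^ 2 / 2 * ((f x (u x) - f x (u x - v x)) * v x)) ∂μ := by
    rw [integral_add (I3.const_mul s) (I4.const_mul (s ^ 2 / 2)), integral_const_mul,
      integral_const_mul]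
  have hle : ∀ᵐ x ∂μ, s * (f x (u x) * v x) + s ^ 2 / 2 * ((f x (u x) - f x (u x - v x)) * v x)
      ≤ ∫ τ in (u x)..(u x + s * v x), f x τ := by
    filter_upwards [hc, hconv] with x hx hxc
    by_cases hvx : v x = 0
    · simp [hvx]
    · obtain ⟨hpos, hxc⟩ := hxc hvx
      have := secant_quadratic_le_integral_scaled hx hpos hxc hs
      linarith
  rw [e]
  refine ⟨integral_mono_ae I5 hJ hle, fun hstrict hs0 hv0 => ?_⟩
  refine lt_of_le_of_ne (integral_mono_ae I5 hJ hle) fun heq => hv0 ?_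
  -- Equality of the integrals forces equality almost everywhere, which the pointwise strict
  -- inequality permits only where `v = 0`.
  have hae := (integral_eq_iff_of_ae_le I5 hJ hle).1 heq
  filter_upwards [hae, hc, hconv, hstrict] with x hx1 hx hxc hxs
  by_contra hvx
  obtain ⟨hpos, hxc⟩ := hxc hvx
  have := secant_quadratic_lt_integral_scaled hx hpos hxc (hxs hvx) hs hs0
  linarith

end Superposition

theorem integrable_inner_of_memLp_two {α F : Type*} [MeasurableSpace α] {μ : Measure α}
    [NormedAddCommGroup F] [InnerProductSpace ℝ F] {G H : α → F} (hG : MemLp G 2 μ)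
    (hH : MemLp H 2 μ) : Integrable (fun x => (inner ℝ (G x) (H x) : ℝ)) μ :=
  (hG.norm.integrable_mul hH.norm).mono' (hG.1.inner hH.1)
    (.of_forall fun x => norm_inner_le_norm (G x) (H x))

/-- Two continuous functions that agree almost everywhere on an open set agree on it; this is
applied to `max g h` and `h`. It turns the almost-everywhere hypotheses on `f` into bounds on
Laplacians at every point. -/
theorem le_of_ae_le_of_continuousOn {E : Type*} [TopologicalSpace E] [MeasurableSpace E]
    [BorelSpace E] {μ : Measure E} [μ.IsOpenPosMeasure] {U : Set E} (hU : IsOpen U) {g h : E → ℝ}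
    (hg : ContinuousOn g U) (hh : ContinuousOn h U) (hle : ∀ᵐ x ∂μ.restrict U, g x ≤ h x) :
    ∀ x ∈ U, g x ≤ h x := by
  have := Measure.eqOn_open_of_ae_eq (μ := μ) (f := fun x => max (g x) (h x)) (g := h)
    (hle.mono fun x hx => max_eq_right hx) hU (ContinuousOn.sup hg hh) hh
  exact fun x hx => max_eq_right_iff.1 (this hx)

/-! ### Classical solutions in `H¹₀` and the expansion of the energy. -/

namespace PartialSymmetry

variable {N : ℕ}

local notation "E" => EuclideanSpace ℝ (Fin N)

variable {Ω : Set (EuclideanSpace ℝ (Fin N))}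

theorem hasWeakGradient_gradient (hΩ : IsOpen Ω) {u : E → ℝ} (hu : ContDiffOn ℝ 1 u Ω) :
    HasWeakGradient Ω u (gradient u) := by
  have hgc := continuousOn_gradient hΩ hu
  refine ⟨hu.continuousOn.locallyIntegrableOn hΩ.measurableSet,
    hgc.locallyIntegrableOn hΩ.measurableSet, fun φ hφ => ?_⟩
  have hgφ : Continuous (gradient φ) := (hφ.1.of_le (by simp)).continuous_gradient
  have I1 : IntegrableOn (fun x => u x • gradient φ x) Ω := by
    refine IntegrableOn.of_forall_sdiff_eq_zero (s := tsupport φ) ?_ hΩ.measurableSet fun x hx => ?_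
    · exact ((hu.continuousOn.smul hgφ.continuousOn).mono hφ.2.2).integrableOn_compact
        hφ.2.1.isCompact
    · rw [gradient_eq_zero_of_notMem_tsupport hx.2, smul_zero]
  have I2 : IntegrableOn (fun x => φ x • gradient u x) Ω := by
    refine IntegrableOn.of_forall_sdiff_eq_zero (s := tsupport φ) ?_ hΩ.measurableSet fun x hx => ?_
    · exact ((hφ.1.continuous.continuousOn.smul hgc).mono hφ.2.2).integrableOn_compact
        hφ.2.1.isCompact
    · rw [image_eq_zero_of_notMem_tsupport hx.2, zero_smul]
  refine ext_inner_left ℝ fun c => ?_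
  rw [inner_neg_right, ← integral_inner I1, ← integral_inner I2]
  have hc : ∀ (χ : E → ℝ) x, inner ℝ c (gradient χ x) = fderiv ℝ χ x c := fun χ x => by
    rw [real_inner_comm, inner_gradient_left]
  simp only [inner_smul_right, hc]
  rw [setIntegral_eq_integral_of_forall_compl_eq_zero,
    setIntegral_eq_integral_of_forall_compl_eq_zero]
  · have hd : Continuous fun x => fderiv ℝ φ x c :=
      (hφ.1.continuous_fderiv (by simp)).clm_apply continuous_const
    have hdu : ContinuousOn (fun x => fderiv ℝ u x c) Ω :=
      (hu.continuousOn_fderiv_of_isOpen hΩ le_rfl).clm_apply continuousOn_const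
    have := integral_bilinear_hasFDerivAt_right_eq_neg_left_of_integrable (μ := volume)
      (B := ContinuousLinearMap.mul ℝ ℝ) (f := φ) (f' := fderiv ℝ φ) (v := c)
      (g := u) (g' := fderiv ℝ u)
      (integrable_mul_of_tsupport_subset hΩ hd (hφ.2.1.fderiv_apply ℝ c)
        ((tsupport_fderiv_apply_subset ℝ c).trans hφ.2.2) hu.continuousOn)
      (integrable_mul_of_tsupport_subset hΩ hφ.1.continuous hφ.2.1 hφ.2.2 hdu)
      (integrable_mul_of_tsupport_subset hΩ hφ.1.continuous hφ.2.1 hφ.2.2 hu.continuousOn)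
      (fun x _ => (hφ.differentiable x).hasFDerivAt)
      (fun x hx => ((hu.differentiableOn one_ne_zero x (hφ.2.2 hx)).differentiableAt
        (hΩ.mem_nhds (hφ.2.2 hx))).hasFDerivAt)
    simp only [ContinuousLinearMap.mul_apply'] at this
    rw [this, neg_neg]
    simp only [mul_comm]
  · intro x hx
    rw [image_eq_zero_of_notMem_tsupport fun h => hx (hφ.2.2 h), zero_mul]
  · intro x hx
    have : fderiv ℝ φ x = 0 := by
      by_contra h
      exact hx (hφ.2.2 (support_fderiv_subset ℝ h))
    simp [this]

/-- A function `u ∈ C²(Ω) ∩ C(closure Ω)` with bounded Laplacian that vanishes on `∂Ω` belongs to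
`H¹₀(Ω)`. -/
theorem isH10Pair_of_classical (hΩ : IsOpen Ω) (hΩb : Bornology.IsBounded Ω) {u : E → ℝ}
    (hu : ContDiffOn ℝ 2 u Ω) (huc : ContinuousOn u (closure Ω)) (hu0 : ∀ x ∈ frontier Ω, u x = 0)
    {K : ℝ} (hK : ∀ x ∈ Ω, |(Δ u : E → ℝ) x| ≤ K) : IsH10Pair Ω u (gradient u) := by
  have hfin : volume Ω ≠ ⊤ := hΩb.measure_lt_top.ne
  have h1 := (isH10Pair_posPart hΩ hΩ subset_rfl hΩb hu huc hu0 hK).1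
  have hK' : ∀ x ∈ Ω, |(Δ (-u) : E → ℝ) x| ≤ K := fun x hx => by
    rw [InnerProductSpace.laplacian_neg, Pi.neg_apply, abs_neg]
    exact hK x hx
  have h2 := (isH10Pair_posPart hΩ hΩ subset_rfl hΩb hu.neg huc.neg
    (fun x hx => by simp [hu0 x hx]) hK').1
  have h3 := h1.add (h2.const_smul (-1))
  have hmem : ∀ᵐ x ∂volume.restrict Ω, x ∈ Ω := ae_restrict_mem hΩ.measurableSet
  have h4 := h3.congr (v := u) (H := _) (hmem.mono fun x hx => by
    simp only [Pi.add_apply, Pi.smul_apply, indicator_of_mem hx, smul_eq_mul]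
    rcases le_total 0 (u x) with h | h
    · rw [max_eq_left h, max_eq_right (by simpa using h)]
      ring
    · rw [max_eq_right h, max_eq_left (by simpa using h)]
      simp) .rfl
  -- The positive and negative parts yield `∇u` cut off to `u ≠ 0`. Uniqueness of the weak gradient
  -- identifies it with `∇u`, with no analysis of the zero set.
  exact h4.congr .rfl ((h4.hasWeakGradient hfin).ae_eq hΩ
    (hasWeakGradient_gradient hΩ (hu.of_le one_le_two)))

variable {f : EuclideanSpace ℝ (Fin N) → ℝ → ℝ} {u₀ v₁ v₂ : EuclideanSpace ℝ (Fin N) → ℝ}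
  {g G₁ G₂ : EuclideanSpace ℝ (Fin N) → EuclideanSpace ℝ (Fin N)}

theorem IsH10Pair.linear_combination (h₁ : IsH10Pair Ω v₁ G₁) (h₂ : IsH10Pair Ω v₂ G₂) (s t : ℝ) :
    IsH10Pair Ω (fun x => s * v₁ x + t * v₂ x) (fun x => s • G₁ x + t • G₂ x) :=
  (h₁.const_smul s).add (h₂.const_smul t)

/-- Expansion of the shifted energy along two bounded `H¹₀` directions with disjoint supports. -/
theorem shiftedEnergy_eq (hΩ : IsOpen Ω) (hΩb : Bornology.IsBounded Ω) (hf : IsCaratheodory Ω f)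
    (h₀ : IsH10Pair Ω u₀ g) (h₁ : IsH10Pair Ω v₁ G₁) (h₂ : IsH10Pair Ω v₂ G₂)
    (hG : ∀ x, inner ℝ (G₁ x) (G₂ x) = (0 : ℝ)) (hv : ∀ x, v₁ x = 0 ∨ v₂ x = 0) {T B : ℝ}
    (hB : ∀ᵐ x ∂volume.restrict Ω, ∀ t, |t| ≤ T → |f x t| ≤ B)
    (hT₁ : ∀ᵐ x ∂volume.restrict Ω, |u₀ x| + |v₁ x| ≤ T)
    (hT₂ : ∀ᵐ x ∂volume.restrict Ω, |u₀ x| + |v₂ x| ≤ T) {s t : ℝ} (hs : s ∈ Icc (-1 : ℝ) 1)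
    (ht : t ∈ Icc (-1 : ℝ) 1) :
    IntegrableOn (energyDensity Ω f fun x => (s * v₁ x + t * v₂ x) + u₀ x) Ω ∧
      shiftedEnergy Ω f u₀ (fun x => s * v₁ x + t * v₂ x)
        = (s * (∫ x in Ω, inner ℝ (g x) (G₁ x)) + s ^ 2 / 2 * (∫ x in Ω, ‖G₁ x‖ ^ 2)
            - ∫ x in Ω, ∫ τ in (u₀ x)..(u₀ x + s * v₁ x), f x τ)
          + (t * (∫ x in Ω, inner ℝ (g x) (G₂ x)) + t ^ 2 / 2 * (∫ x in Ω, ‖G₂ x‖ ^ 2)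
            - ∫ x in Ω, ∫ τ in (u₀ x)..(u₀ x + t * v₂ x), f x τ) := by
  have hfin : volume Ω ≠ ⊤ := hΩb.measure_lt_top.ne
  have : IsFiniteMeasure (volume.restrict Ω) := ⟨by simpa [lt_top_iff_ne_top] using hfin⟩
  have hu₀m := h₀.1.1.aemeasurable
  have hv₁m := h₁.1.1.aemeasurable
  have hv₂m := h₂.1.1.aemeasurable
  have hpair : IsH10Pair Ω (fun x => (s * v₁ x + t * v₂ x) + u₀ x)
      (fun x => (s • G₁ x + t • G₂ x) + g x) := (h₁.linear_combination h₂ s t).add h₀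
  have huT : ∀ᵐ x ∂volume.restrict Ω, |u₀ x| ≤ T :=
    hT₁.mono fun x hx => by linarith [abs_nonneg (v₁ x)]
  have hshiftT : ∀ᵐ x ∂volume.restrict Ω, |(s * v₁ x + t * v₂ x) + u₀ x| ≤ T := by
    filter_upwards [hT₁, hT₂] with x hx1 hx2
    rcases hv x with h | h
    · have := abs_add_mul_le hx2 ht
      rwa [h, mul_zero, zero_add, add_comm]
    · have := abs_add_mul_le hx1 hs
      rwa [h, mul_zero, add_zero, add_comm]
  have hdens : ∀ {w : E → ℝ} {G : E → E}, IsH10Pair Ω w G →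
      (∀ᵐ x ∂volume.restrict Ω, |w x| ≤ T) →
      energyDensity Ω f w =ᵐ[volume.restrict Ω]
          (fun x => 1 / 2 * ‖G x‖ ^ 2 - ∫ τ in (0 : ℝ)..(w x), f x τ) ∧
        IntegrableOn (energyDensity Ω f w) Ω := by
    intro w G h hT
    have e : energyDensity Ω f w =ᵐ[volume.restrict Ω]
        (fun x => 1 / 2 * ‖G x‖ ^ 2 - ∫ τ in (0 : ℝ)..(w x), f x τ) := by
      filter_upwards [h.weakGradient_ae_eq hΩ hfin] with x hx
      rw [energyDensity, hx]
    refine ⟨e, Integrable.congr ?_ e.symm⟩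
    exact (((memLp_two_iff_integrable_sq_norm h.2.1.1).1 h.2.1).const_mul (1 / 2)).sub
      (integrable_intervalIntegral_superposition hf.1 hf.2 hB h.1.1.aemeasurable hT)
  obtain ⟨e1, I1⟩ := hdens hpair hshiftT
  obtain ⟨e0, I0⟩ := hdens h₀ huT
  refine ⟨I1, ?_⟩
  have J1 := integrable_intervalIntegral_shift hf.1 hf.2 hB hu₀m hv₁m hT₁ hs
  have J2 := integrable_intervalIntegral_shift hf.1 hf.2 hB hu₀m hv₂m hT₂ ht
  have S1 := (memLp_two_iff_integrable_sq_norm h₁.2.1.1).1 h₁.2.1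
  have S2 := (memLp_two_iff_integrable_sq_norm h₂.2.1.1).1 h₂.2.1
  have K1 : Integrable (fun x => (inner ℝ (g x) (G₁ x) : ℝ)) (volume.restrict Ω) :=
    integrable_inner_of_memLp_two h₀.2.1 h₁.2.1
  have K2 : Integrable (fun x => (inner ℝ (g x) (G₂ x) : ℝ)) (volume.restrict Ω) :=
    integrable_inner_of_memLp_two h₀.2.1 h₂.2.1
  have A1 : Integrable (fun x => s * inner ℝ (g x) (G₁ x) + s ^ 2 / 2 * ‖G₁ x‖ ^ 2)
      (volume.restrict Ω) := (K1.const_mul s).add (S1.const_mul (s ^ 2 / 2))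
  have A2 : Integrable (fun x => t * inner ℝ (g x) (G₂ x) + t ^ 2 / 2 * ‖G₂ x‖ ^ 2)
      (volume.restrict Ω) := (K2.const_mul t).add (S2.const_mul (t ^ 2 / 2))
  have D1 : Integrable (fun x => s * inner ℝ (g x) (G₁ x) + s ^ 2 / 2 * ‖G₁ x‖ ^ 2
      - ∫ τ in (u₀ x)..(u₀ x + s * v₁ x), f x τ) (volume.restrict Ω) := A1.sub J1
  have D2 : Integrable (fun x => t * inner ℝ (g x) (G₂ x) + t ^ 2 / 2 * ‖G₂ x‖ ^ 2
      - ∫ τ in (u₀ x)..(u₀ x + t * v₂ x), f x τ) (volume.restrict Ω) := A2.sub J2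
  rw [shiftedEnergy, energy, energy, ← integral_sub I1 I0]
  rw [← integral_const_mul, ← integral_const_mul, ← integral_const_mul, ← integral_const_mul,
    ← integral_add (K1.const_mul s) (S1.const_mul (s ^ 2 / 2)),
    ← integral_add (K2.const_mul t) (S2.const_mul (t ^ 2 / 2)), ← integral_sub A1 J1,
    ← integral_sub A2 J2, ← integral_add D1 D2]
  refine integral_congr_ae ?_
  filter_upwards [e1, e0, hf.2] with x hx1 hx0 hxc
  rw [hx1, hx0]
  have hn : ‖(s • G₁ x + t • G₂ x) + g x‖ ^ 2 = ‖g x‖ ^ 2 + 2 * s * inner ℝ (g x) (G₁ x)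
      + 2 * t * inner ℝ (g x) (G₂ x) + s ^ 2 * ‖G₁ x‖ ^ 2 + t ^ 2 * ‖G₂ x‖ ^ 2 := by
    rw [norm_add_sq_real, norm_add_sq_real, inner_add_left, inner_smul_left, inner_smul_left,
      inner_smul_left, inner_smul_right, hG, real_inner_comm (g x) (G₁ x),
      real_inner_comm (g x) (G₂ x), norm_smul, norm_smul, mul_pow, mul_pow, Real.norm_eq_abs,
      Real.norm_eq_abs, sq_abs, sq_abs]
    simp only [conj_trivial]
    ring
  have hF : (∫ τ in (0 : ℝ)..((s * v₁ x + t * v₂ x) + u₀ x), f x τ) - ∫ τ in (0 : ℝ)..(u₀ x), f x τ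
      = (∫ τ in (u₀ x)..(u₀ x + s * v₁ x), f x τ) + ∫ τ in (u₀ x)..(u₀ x + t * v₂ x), f x τ := by
    rw [intervalIntegral.integral_interval_sub_left (hxc.intervalIntegrable _ _)
      (hxc.intervalIntegrable _ _)]
    rcases hv x with h | h
    · simp [h, add_comm]
    · simp [h, add_comm]
  rw [hn]
  linarith

end PartialSymmetry

/-! ### The difference between `u` and its reflection. -/

namespace PartialSymmetry

variable {N : ℕ} [NeZero N]

local notation "E" => EuclideanSpace ℝ (Fin N)

variable {Ω : Set (EuclideanSpace ℝ (Fin N))}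

/-- The odd part (times two) `u(x) - u(x̃)`. -/
noncomputable def oddDiff (u : EuclideanSpace ℝ (Fin N) → ℝ) : EuclideanSpace ℝ (Fin N) → ℝ :=
  fun x => u x - u (reflect x)

theorem reflNegPart_eq (S : Set E) (u : E → ℝ) :
    reflNegPart S u = S.indicator fun x => max (oddDiff u x) 0 := by
  simp only [reflNegPart, oddDiff, neg_sub]

theorem oddDiff_reflect (u : E → ℝ) (x : E) : oddDiff u (reflect x) = -oddDiff u x := by
  simp [oddDiff]

section OddDiff

variable {u : EuclideanSpace ℝ (Fin N) → ℝ}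

theorem contDiffOn_comp_reflect (hΩs : ∀ x ∈ Ω, reflect x ∈ Ω) (hu : ContDiffOn ℝ 2 u Ω) :
    ContDiffOn ℝ 2 (fun x => u (reflect x)) Ω :=
  hu.comp contDiff_reflect.contDiffOn hΩs

theorem contDiffOn_oddDiff (hΩs : ∀ x ∈ Ω, reflect x ∈ Ω) (hu : ContDiffOn ℝ 2 u Ω) :
    ContDiffOn ℝ 2 (oddDiff u) Ω :=
  hu.sub (contDiffOn_comp_reflect hΩs hu)

theorem continuousOn_oddDiff (hΩs : ∀ x ∈ Ω, reflect x ∈ Ω) (hu : ContinuousOn u (closure Ω)) :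
    ContinuousOn (oddDiff u) (closure Ω) :=
  hu.sub (hu.comp contDiff_reflect.continuous.continuousOn fun _ hx => reflect_mem_closure hΩs hx)

theorem laplacian_oddDiff (hΩ : IsOpen Ω) (hΩs : ∀ x ∈ Ω, reflect x ∈ Ω)
    (hu : ContDiffOn ℝ 2 u Ω) {x : E} (hx : x ∈ Ω) :
    (Δ (oddDiff u) : E → ℝ) x = (Δ u : E → ℝ) x - (Δ u : E → ℝ) (reflect x) := by
  have h1 := hu.contDiffAt (hΩ.mem_nhds hx)
  have h2 := (contDiffOn_comp_reflect hΩs hu).contDiffAt (hΩ.mem_nhds hx)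
  rw [← laplacian_comp_reflect (hu.contDiffAt (hΩ.mem_nhds (hΩs x hx)))]
  exact h1.laplacian_sub h2

theorem fderiv_oddDiff_eq_zero (hΩ : IsOpen Ω)
    (hu : ContDiffOn ℝ 2 u Ω) {P : E} (hP : P ∈ Ω) (hP0 : P 0 = 0) (hd : fderiv ℝ u P = 0) :
    fderiv ℝ (oddDiff u) P = 0 := by
  have hud : DifferentiableAt ℝ u P :=
    (hu.contDiffAt (hΩ.mem_nhds hP)).differentiableAt two_ne_zero
  have h1 : HasFDerivAt u 0 P := hd ▸ hud.hasFDerivAt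
  have h2 : HasFDerivAt u (0 : E →L[ℝ] ℝ) (reflect P) := by rwa [reflect_eq_self hP0]
  have h3 := h2.comp P (contDiff_reflect.differentiable two_ne_zero P).hasFDerivAt
  have h4 := h1.sub h3
  rw [ContinuousLinearMap.zero_comp, sub_zero] at h4
  exact h4.fderiv

end OddDiff

/-- The boundary of a half domain lies in `∂Ω ∪ T`: on `∂Ω` both terms vanish, on `T` they coincide.
-/
theorem oddDiff_eq_zero_of_frontier {u : E → ℝ} (hΩ : IsOpen Ω) (hΩs : ∀ x ∈ Ω, reflect x ∈ Ω)
    (hu0 : ∀ x ∈ frontier Ω, u x = 0) {S : Set E} (hS : S = halfPos Ω ∨ S = halfNeg Ω) :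
    ∀ x ∈ frontier S, oddDiff u x = 0 := by
  intro x hx
  have hx' : x ∈ frontier Ω ∪ {x | x 0 = 0} := by
    rcases hS with rfl | rfl
    · exact frontier_halfPos_subset hΩ hx
    · exact frontier_halfNeg_subset hΩ hx
  rcases hx' with h | h
  · rw [oddDiff, hu0 x h, hu0 _ (reflect_mem_frontier hΩs h), sub_zero]
  · rw [oddDiff, reflect_eq_self h, sub_self]

/-- If `u` has a critical point on `T ∩ Ω` and `|Δw| ≤ L |w|` for `w(x) = u(x) - u(x̃)`, then `w`
takes positive values in both half domains, unless `u` is even. -/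
theorem not_ae_eq_zero_reflNegPart (hΩ : IsOpen Ω) (hΩc : IsPreconnected Ω)
    (hΩs : ∀ x ∈ Ω, reflect x ∈ Ω) {u : E → ℝ} (hu : ContDiffOn ℝ 2 u Ω) {L : ℝ} (hL : 0 ≤ L)
    (hΔ : ∀ x ∈ Ω, |(Δ (oddDiff u) : E → ℝ) x| ≤ L * |oddDiff u x|)
    (hcrit : ∃ P ∈ Ω, P 0 = 0 ∧ fderiv ℝ u P = 0) (hne : ¬ ∀ x ∈ Ω, u (reflect x) = u x)
    {S : Set E} (hS : S = halfPos Ω ∨ S = halfNeg Ω) :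
    ¬ reflNegPart S u =ᵐ[volume.restrict Ω] 0 := by
  intro h0
  have hSΩ : S ⊆ Ω := by
    rcases hS with rfl | rfl <;> exact fun x hx => hx.1
  have hSo : IsOpen S := by
    rcases hS with rfl | rfl
    · exact isOpen_halfPos hΩ
    · exact isOpen_halfNeg hΩ
  have hw := contDiffOn_oddDiff hΩs hu
  have hle : ∀ x ∈ S, oddDiff u x ≤ 0 := by
    refine le_of_ae_le_of_continuousOn (μ := volume) hSo (hw.continuousOn.mono hSΩ)
      continuousOn_const ?_
    filter_upwards [ae_mono (Measure.restrict_mono hSΩ le_rfl) h0, ae_restrict_mem hSo.measurableSet]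
      with x hx hxS
    rw [reflNegPart_eq, indicator_of_mem hxS] at hx
    exact max_eq_right_iff.1 hx
  obtain ⟨P, hP, hP0, hPd⟩ := hcrit
  have hd := fderiv_oddDiff_eq_zero hΩ hu hP hP0 hPd
  have hzero : ∀ x ∈ Ω, oddDiff u x = 0 := by
    -- A vanishing positive part in `Ω₊` means that `-w ≥ 0` there; in `Ω₋` it means, by oddness,
    -- that `w ≥ 0` in `Ω₊`.
    rcases hS with rfl | rfl
    · have := eq_zero_of_odd_of_laplacian_le hΩ hΩc hΩs hw.neg
        (fun x _ => by rw [oddDiff_reflect]) hL (fun x hx => ?_)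
        (fun x hx => neg_nonneg.2 (hle x hx)) hP hP0 (by rw [fderiv_fun_neg, hd, neg_zero])
      · exact fun x hx => neg_eq_zero.1 (this x hx)
      · have h1 := hΔ x hx.1
        rw [abs_of_nonpos (hle x hx)] at h1
        have h2 : (Δ (fun x => -oddDiff u x) : E → ℝ) x = -(Δ (oddDiff u) : E → ℝ) x :=
          congrFun (InnerProductSpace.laplacian_neg (f := oddDiff u)) x
        rw [h2]
        exact (neg_le_abs _).trans h1
    · have hge : ∀ x ∈ halfPos Ω, 0 ≤ oddDiff u x := fun x hx => by
        have := hle (reflect x) ⟨hΩs x hx.1, by simpa using hx.2⟩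
        rw [oddDiff_reflect] at this
        linarith
      refine eq_zero_of_odd_of_laplacian_le hΩ hΩc hΩs hw (fun x _ => oddDiff_reflect u x) hL
        (fun x hx => ?_) hge hP hP0 hd
      have h1 := hΔ x hx.1
      rw [abs_of_nonneg (hge x hx)] at h1
      exact (le_abs_self _).trans h1
  exact hne fun x hx => (sub_eq_zero.1 (hzero x hx)).symm

end PartialSymmetry

/-! ### The main theorem. -/

theorem proposition1p3 {N : ℕ} [NeZero N] (hN : 2 ≤ N)
    (Ω : Set (EuclideanSpace ℝ (Fin N)))
    (hΩ_open : IsOpen Ω) (hΩ_conn : IsConnected Ω) (hΩ_bdd : Bornology.IsBounded Ω)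
    (hΩ_zero : (0 : EuclideanSpace ℝ (Fin N)) ∈ Ω)
    (hΩ_symm : ∀ x ∈ Ω, reflect x ∈ Ω)
    (f : EuclideanSpace ℝ (Fin N) → ℝ → ℝ)
    (hf : IsCaratheodory Ω f)
    (hf_even : ∀ᵐ x ∂volume.restrict Ω, ∀ t, f (reflect x) t = f x t)
    (u₀ : EuclideanSpace ℝ (Fin N) → ℝ)
    (hu₀ : IsClassicalSolution Ω f u₀)
    -- the subcritical growth condition
    (C r : ℝ) (hC : 0 < C) (hr : 1 < r)
    (hr_sub : 3 ≤ N → r < 2 * (N : ℝ) / ((N : ℝ) - 2))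
    (hgrowth : ∀ᵐ x ∂volume.restrict Ω, ∀ t : ℝ, |f x t| ≤ C * (|t| ^ (r - 1) + 1))
    -- the local Lipschitz condition
    (hLip : ∀ M : ℝ, 0 < M → ∃ C_M : ℝ, 0 < C_M ∧ ∀ᵐ x ∂volume.restrict Ω,
      ∀ s ∈ Icc (-M) M, ∀ t ∈ Icc (-M) M, |f x s - f x t| ≤ C_M * |s - t|)
    -- the convexity condition, in both half domains
    (hconv : ∀ S ∈ ({halfPos Ω, halfNeg Ω} : Set (Set (EuclideanSpace ℝ (Fin N)))),
      ∀ᵐ x ∂volume.restrict S, reflNegPart S u₀ x ≠ 0 →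
        ConvexOn ℝ (Icc (u₀ (reflect x)) (2 * u₀ x - u₀ (reflect x))) (f x))
    -- a critical point on `T ∩ Ω`
    (hcrit : ∃ P ∈ Ω, P 0 = 0 ∧ fderiv ℝ u₀ P = 0)
    (hnot_even : ¬ ∀ x ∈ Ω, u₀ (reflect x) = u₀ x) :
    -- the functions involved lie in the domain of the functional, whose integrals converge
    (MemH10 Ω u₀ ∧ MemH10 Ω (reflNegPart (halfPos Ω) u₀) ∧
      MemH10 Ω (reflNegPart (halfNeg Ω) u₀)) ∧
    (∀ s ∈ Icc (-1 : ℝ) 1, ∀ t ∈ Icc (-1 : ℝ) 1,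
      MemH10 Ω (fun x =>
        s * reflNegPart (halfPos Ω) u₀ x + t * reflNegPart (halfNeg Ω) u₀ x) ∧
      IntegrableOn (energyDensity Ω f (fun x =>
        (s * reflNegPart (halfPos Ω) u₀ x + t * reflNegPart (halfNeg Ω) u₀ x) + u₀ x)) Ω ∧
      shiftedEnergy Ω f u₀ (fun x =>
        s * reflNegPart (halfPos Ω) u₀ x + t * reflNegPart (halfNeg Ω) u₀ x) ≤ 0) ∧
    ((∀ S ∈ ({halfPos Ω, halfNeg Ω} : Set (Set (EuclideanSpace ℝ (Fin N)))),
        ∀ᵐ x ∂volume.restrict S, reflNegPart S u₀ x ≠ 0 →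
          StrictConvexOn ℝ (Icc (u₀ (reflect x)) (u₀ x)) (f x)) →
      ∀ s ∈ Ioo (-1 : ℝ) 1, ∀ t ∈ Ioo (-1 : ℝ) 1, (s, t) ≠ (0, 0) →
        shiftedEnergy Ω f u₀ (fun x =>
          s * reflNegPart (halfPos Ω) u₀ x + t * reflNegPart (halfNeg Ω) u₀ x) < 0) := by
  obtain ⟨hu2, huc, heq, hu0⟩ := hu₀
  have hfin : volume Ω ≠ ⊤ := hΩ_bdd.measure_lt_top.ne
  have : IsFiniteMeasure (volume.restrict Ω) := ⟨by simpa [lt_top_iff_ne_top] using hfin⟩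
  have hΩm := hΩ_open.measurableSet
  have hmem : ∀ᵐ x ∂volume.restrict Ω, x ∈ Ω := ae_restrict_mem hΩm
  -- bounds
  obtain ⟨M, hM0, hM⟩ : ∃ M : ℝ, 0 < M ∧ ∀ x ∈ closure Ω, |u₀ x| ≤ M := by
    obtain ⟨M, hM⟩ := hΩ_bdd.isCompact_closure.exists_bound_of_continuousOn huc
    exact ⟨max M 1, by positivity, fun x hx => (hM x hx).trans (le_max_left _ _)⟩
  have hMΩ : ∀ x ∈ Ω, |u₀ x| ≤ M := fun x hx => hM x (subset_closure hx)
  -- Since `|u₀| ≤ M` and the negative parts are at most `2M`, every argument of `f` that occurs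
  -- lies in `[-T, T]`, where `|f| ≤ B`.
  set T := 3 * M
  set B := C * (T ^ (r - 1) + 1)
  have hB : ∀ᵐ x ∂volume.restrict Ω, ∀ t, |t| ≤ T → |f x t| ≤ B := by
    filter_upwards [hgrowth] with x hx t ht
    refine (hx t).trans (mul_le_mul_of_nonneg_left ?_ hC.le)
    have := Real.rpow_le_rpow (abs_nonneg t) ht (sub_nonneg.2 hr.le)
    linarith
  have hΔc : ContinuousOn (Δ u₀ : EuclideanSpace ℝ (Fin N) → ℝ) Ω :=
    continuousOn_laplacian hΩ_open hu2
  have hΔB : ∀ x ∈ Ω, |(Δ u₀ : EuclideanSpace ℝ (Fin N) → ℝ) x| ≤ B := by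
    refine le_of_ae_le_of_continuousOn (μ := volume) hΩ_open hΔc.abs continuousOn_const ?_
    filter_upwards [hB, hmem] with x hx hxΩ
    have h1 := heq x hxΩ
    rw [← abs_neg, h1]
    exact hx _ ((hMΩ x hxΩ).trans (by simp only [T]; linarith))
  have hW2 := contDiffOn_oddDiff hΩ_symm hu2
  have hΔW : ∀ x ∈ Ω, (Δ (oddDiff u₀) : EuclideanSpace ℝ (Fin N) → ℝ) x
      = f (reflect x) (u₀ (reflect x)) - f x (u₀ x) := fun x hx => by
    rw [laplacian_oddDiff hΩ_open hΩ_symm hu2 hx, ← heq x hx, ← heq _ (hΩ_symm x hx)]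
    ring
  have hΔWB : ∀ x ∈ Ω, |(Δ (oddDiff u₀) : EuclideanSpace ℝ (Fin N) → ℝ) x| ≤ 2 * B :=
    fun x hx => by
      rw [laplacian_oddDiff hΩ_open hΩ_symm hu2 hx]
      have := (abs_sub _ _).trans (add_le_add (hΔB x hx) (hΔB _ (hΩ_symm x hx)))
      linarith
  obtain ⟨L, hL, hLip⟩ := hLip M hM0
  have hΔL : ∀ x ∈ Ω, |(Δ (oddDiff u₀) : EuclideanSpace ℝ (Fin N) → ℝ) x|
      ≤ L * |oddDiff u₀ x| := by
    refine le_of_ae_le_of_continuousOn (μ := volume) hΩ_open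
      (continuousOn_laplacian hΩ_open hW2).abs
      (continuousOn_const.mul hW2.continuousOn.abs) ?_
    filter_upwards [hmem, hf_even, hLip] with x hx hev hl
    rw [hΔW x hx, hev, abs_sub_comm, oddDiff]
    exact hl _ (abs_le.1 (hMΩ x hx)) _ (abs_le.1 (hMΩ _ (hΩ_symm x hx)))
  have hntriv : ∀ S, S = halfPos Ω ∨ S = halfNeg Ω →
      ¬ reflNegPart S u₀ =ᵐ[volume.restrict Ω] 0 := fun S hS =>
    not_ae_eq_zero_reflNegPart hΩ_open hΩ_conn.isPreconnected hΩ_symm hu2 hL.le hΔL hcrit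
      hnot_even hS
  -- the solution as an element of `H¹₀`
  have hpair₀ : IsH10Pair Ω u₀ (gradient u₀) :=
    isH10Pair_of_classical hΩ_open hΩ_bdd hu2 huc hu0 hΔB
  have hΔL2 : MemLp (Δ u₀ : EuclideanSpace ℝ (Fin N) → ℝ) 2 (volume.restrict Ω) :=
    MemLp.of_bound (hΔc.aestronglyMeasurable hΩm) B (hmem.mono fun x hx => hΔB x hx)
  set G : Set (EuclideanSpace ℝ (Fin N)) → EuclideanSpace ℝ (Fin N) → EuclideanSpace ℝ (Fin N) :=
    fun S => (S ∩ {x | 0 < oddDiff u₀ x}).indicator (gradient (oddDiff u₀))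
  -- The contribution of one half domain to the shifted energy.
  set Q : Set (EuclideanSpace ℝ (Fin N)) → ℝ → ℝ := fun S s =>
    s * (∫ x in Ω, inner ℝ (gradient u₀ x) (G S x)) + s ^ 2 / 2 * (∫ x in Ω, ‖G S x‖ ^ 2)
      - ∫ x in Ω, ∫ τ in (u₀ x)..(u₀ x + s * reflNegPart S u₀ x), f x τ
  have hvT : ∀ S, ∀ᵐ x ∂volume.restrict Ω, |u₀ x| + |reflNegPart S u₀ x| ≤ T := by
    intro S
    filter_upwards [hmem] with x hx
    have h1 := hMΩ x hx
    have h2 := hMΩ _ (hΩ_symm x hx)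
    have h3 : |reflNegPart S u₀ x| ≤ 2 * M := by
      rw [reflNegPart_eq]
      by_cases hxS : x ∈ S
      · rw [indicator_of_mem hxS, abs_of_nonneg (le_max_right _ _)]
        refine max_le ?_ (by linarith)
        rw [oddDiff]
        linarith [(abs_le.1 h1).2, (abs_le.1 h2).1]
      · rw [indicator_of_notMem hxS, abs_zero]
        linarith
    simp only [T]
    linarith
  have half : ∀ S, S = halfPos Ω ∨ S = halfNeg Ω → IsH10Pair Ω (reflNegPart S u₀) (G S) ∧
      ∀ s ∈ Icc (-1 : ℝ) 1, Q S s ≤ 0 ∧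
        ((∀ᵐ x ∂volume.restrict S, reflNegPart S u₀ x ≠ 0 →
          StrictConvexOn ℝ (Icc (u₀ (reflect x)) (u₀ x)) (f x)) → s ≠ 0 → Q S s < 0) := by
    intro S hS
    have hSΩ : S ⊆ Ω := by
      rcases hS with rfl | rfl <;> exact fun x hx => hx.1
    have hSo : IsOpen S := by
      rcases hS with rfl | rfl
      · exact isOpen_halfPos hΩ_open
      · exact isOpen_halfNeg hΩ_open
    have hSm : S ∈ ({halfPos Ω, halfNeg Ω} : Set (Set (EuclideanSpace ℝ (Fin N)))) := hS
    obtain ⟨hpair, hsq⟩ := isH10Pair_posPart hSo hΩ_open hSΩ hΩ_bdd (hW2.mono hSΩ)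
      ((continuousOn_oddDiff hΩ_symm huc).mono (closure_mono hSΩ))
      (oddDiff_eq_zero_of_frontier hΩ_open hΩ_symm hu0 hS) (fun x hx => hΔWB x (hSΩ hx))
    rw [← reflNegPart_eq] at hpair hsq
    refine ⟨hpair, fun s hs => ?_⟩
    -- on the support of the negative part
    have hval : ∀ x, reflNegPart S u₀ x ≠ 0 → x ∈ S ∧ 0 < reflNegPart S u₀ x ∧
        u₀ x - reflNegPart S u₀ x = u₀ (reflect x) ∧
        u₀ x + reflNegPart S u₀ x = 2 * u₀ x - u₀ (reflect x) := by
      intro x hx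
      rw [reflNegPart_eq] at hx ⊢
      have hxS : x ∈ S := by
        by_contra h
        exact hx (indicator_of_notMem h _)
      rw [indicator_of_mem hxS] at hx ⊢
      have hpos : 0 < oddDiff u₀ x := by
        by_contra h
        exact hx (max_eq_right (not_lt.1 h))
      rw [max_eq_left hpos.le]
      refine ⟨hxS, hpos, ?_, ?_⟩ <;> rw [oddDiff] <;> ring
    have hweak := hpair.setIntegral_inner_gradient hΩ_open hu2 hpair₀.2.1 hΔL2
    -- The weak form of the equation for `u₀`, tested with the negative part.
    have e1 : ∫ x in Ω, inner ℝ (gradient u₀ x) (G S x)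
        = ∫ x in Ω, f x (u₀ x) * reflNegPart S u₀ x := by
      refine hweak.trans (setIntegral_congr_fun hΩm fun x hx => ?_)
      simp only [heq x hx]
    -- The equation for `w` tested with its own positive part: evenness replaces `f(x̃,·)` by
    -- `f(x,·)`, and `u₀(x̃) = u₀ - v` where `v ≠ 0`.
    have e2 : ∫ x in Ω, ‖G S x‖ ^ 2
        = ∫ x in Ω, (f x (u₀ x) - f x (u₀ x - reflNegPart S u₀ x)) * reflNegPart S u₀ x := by
      refine hsq.trans (integral_congr_ae ?_)
      filter_upwards [hmem, hf_even] with x hx hev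
      by_cases hv : reflNegPart S u₀ x = 0
      · simp [hv]
      · rw [(hval x hv).2.2.1, hΔW x hx, hev, neg_sub]
    have hlift : ∀ p : EuclideanSpace ℝ (Fin N) → Prop, (∀ᵐ x ∂volume.restrict S, p x) →
        ∀ᵐ x ∂volume.restrict Ω, x ∈ S → p x := fun p hp =>
      ae_restrict_of_ae ((ae_restrict_iff' hSo.measurableSet).1 hp)
    have hsec := integral_secant_le hf.1 hf.2 hB hpair₀.1.1.aemeasurable hpair.1.1.aemeasurable
      (hvT S) (by
        filter_upwards [hlift _ (hconv S hSm)] with x hx hv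
        obtain ⟨h1, h2, h3, h4⟩ := hval x hv
        rw [h3, h4]
        exact ⟨h2, hx h1 hv⟩) hs
    simp only [Q, e1, e2]
    refine ⟨sub_nonpos.2 hsec.1, fun hstrict hs0 => sub_neg.2 (hsec.2 ?_ hs0 (hntriv S hS))⟩
    filter_upwards [hlift _ hstrict] with x hx hv
    obtain ⟨h1, h2, h3, h4⟩ := hval x hv
    rw [h3]
    exact hx h1 hv
  obtain ⟨hp, hQp⟩ := half _ (.inl rfl)
  obtain ⟨hn, hQn⟩ := half _ (.inr rfl)
  have hdisj : ∀ x : EuclideanSpace ℝ (Fin N), x ∉ halfPos Ω ∨ x ∉ halfNeg Ω := fun x => by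
    by_contra! h
    exact lt_asymm h.1.2 h.2.2
  have hexp : ∀ s ∈ Icc (-1 : ℝ) 1, ∀ t ∈ Icc (-1 : ℝ) 1, _ := fun s hs t ht =>
    shiftedEnergy_eq hΩ_open hΩ_bdd hf hpair₀ hp hn (fun x => by
      rcases hdisj x with h | h
      · rw [show G (halfPos Ω) x = 0 from indicator_of_notMem (fun h' => h h'.1) _,
          inner_zero_left]
      · rw [show G (halfNeg Ω) x = 0 from indicator_of_notMem (fun h' => h h'.1) _,
          inner_zero_right])
      (fun x => (hdisj x).imp (fun h => indicator_of_notMem h _) fun h => indicator_of_notMem h _)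
      hB (hvT _) (hvT _) hs ht
  refine ⟨⟨hpair₀.memH10 hΩ_open hfin, hp.memH10 hΩ_open hfin, hn.memH10 hΩ_open hfin⟩,
    fun s hs t ht => ⟨(hp.linear_combination hn s t).memH10 hΩ_open hfin, (hexp s hs t ht).1, ?_⟩,
    fun hstrict s hs t ht hst => ?_⟩
  · rw [(hexp s hs t ht).2]
    exact add_nonpos (hQp s hs).1 (hQn t ht).1
  · have hs' := Ioo_subset_Icc_self hs
    have ht' := Ioo_subset_Icc_self ht
    rw [(hexp s hs' t ht').2]
    -- One strict term suffices, and it comes from a half domain whose parameter is nonzero.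
    by_cases hs0 : s = 0
    · have ht0 : t ≠ 0 := fun h => hst (by rw [hs0, h])
      exact add_neg_of_nonpos_of_neg (hQp s hs').1
        ((hQn t ht').2 (hstrict _ (.inr rfl)) ht0)
    · exact add_neg_of_neg_of_nonpos ((hQp s hs').2 (hstrict _ (.inl rfl)) hs0) (hQn t ht').1
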